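/- All groups are finite, and all classes of groups are non-empty and closed under isomorphism. Let $\pi$ be a set of primes and $\pi'$ its complement in the set of all primes. A *formation* is a class of groups closed under homomorphic images and subdirect products; for a formation $\mathfrak F$, $G^{\mathfrak F}$ denotes the smallest normal subgroup $N$ of $G$ with $G/N\in\mathfrak F$, and for a class $\mathfrak X$, $\mathfrak X\circ\mathfrak F$ is the class of all groups $G$ with $G^{\mathfrak F}\in\mathfrak X$. Let $\mathfrak N$ be the class of nilpotent groups; $\mathfrak G_\pi$ the class of $\pi$-groups, with $\mathfrak G_p=\mathfrak G_{\{p\}}$; $\mathfrak N_\pi$ the class of $\pi$-nilpotent groups (groups with a normal $\pi'$-subgroup whose quotient is nilpotent); and $\mathfrak S_\pi$ the class of $\pi$-solvable groups (groups each of whose chief factors is a $p$-group for some $p\in\pi$ or a $\pi'$-group). Let $\mathrm{Crit}_{\mathtt S}(\mathfrak X)$ be the class of all groups $G\notin\mathfrak X$ all of whose proper subgroups belong to $\mathfrak X$. A formation $\mathfrak F$ satisfies the *$\pi$-boundary condition (I)* if $\mathrm{Crit}_{\mathtt S}(\mathfrak F)\subseteq\mathfrak N_\pi\circ\mathfrak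 F$, and the *$\pi$-boundary condition (II)* if $\mathrm{Crit}_{\mathtt S}(\mathfrak G_p\circ\mathfrak F)\subseteq\mathfrak S_\pi\circ\mathfrak F$ for every $p\in\pi$. The *$\pi'\mathfrak F$-norm* of $G$ is $\mathcal N_{\pi'\mathfrak F}(G)=\bigcap_{H\le G}N_G\bigl(H^{\mathfrak F}O_{\pi'}(G)\bigr)$, where $O_{\pi'}(G)$ is the largest normal $\pi'$-subgroup of $G$. Put $\mathcal N^0_{\pi'\mathfrak F}(G)=1$ and $\mathcal N^{i}_{\pi'\mathfrak F}(G)/\mathcal N^{i-1}_{\pi'\mathfrak F}(G)=\mathcal N_{\pi'\mathfrak F}\bigl(G/\mathcal N^{i-1}_{\pi'\mathfrak F}(G)\bigr)$ for $i\ge 1$, and let $\mathcal N^\infty_{\pi'\mathfrak F}(G)$ be the terminal term of this ascending series. For a formation $\mathfrak B$, a chief factor $L/K$ of $G$ is *$\mathfrak B$-central* in $G$ if $(L/K)\rtimes(G/C_G(L/K))\in\mathfrak B$; the *$\pi\mathfrak B$-hypercentre* $Z_{\pi\mathfrak B}(G)$ is the product of all normal subgroups $N$ of $G$ such that every chief factor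 of $G$ below $N$ of order divisible by at least one prime in $\pi$ is $\mathfrak B$-central in $G$. **Theorem.** Let $\mathfrak F$ be a formation that is closed under taking subgroups. Then: (1) If $\mathfrak F$ satisfies the $\pi$-boundary condition (II), then $\mathcal N^\infty_{\pi'\mathfrak F}(G)=Z_{\pi(\mathfrak N\circ\mathfrak F)}(G)$ for every group $G$. (2) If $\mathcal N^\infty_{\pi'\mathfrak F}(G)=Z_{\pi(\mathfrak N\circ\mathfrak F)}(G)$ for every group $G$, then $\mathfrak F$ satisfies the $\pi$-boundary condition (I). (3) $\mathcal N^\infty_{\pi'\mathfrak F}(G)=Z_{\pi(\mathfrak N\circ\mathfrak F)}(G)$ holds for every group $G$ if and only if it holds for every group $G\in\bigcup_{p\in\pi}\bigl(\mathrm{Crit}_{\mathtt S}(\mathfrak G_p\circ\mathfrak F)\setminus(\mathfrak S_\pi\circ\mathfrak F)\bigr)$. -/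

import Mathlib

universe u

/-- A class of finite groups: a property of groups, closed under isomorphism, whose members are
finite. -/
structure GroupClass where
  Mem : ∀ (G : Type u) [Group G], Prop
  finite : ∀ {G : Type u} [Group G], Mem G → Finite G
  iso : ∀ {G H : Type u} [Group G] [Group H], G ≃* H → Mem G → Mem H

namespace GroupClass

/-- A formation: a nonempty class closed under homomorphic images and subdirect products. -/
structure IsFormation (F : GroupClass.{u}) : Prop where
  nonempty : ∃ (G : Type u) (_ : Group G), F.Mem G
  image : ∀ {G H : Type u} [Group G] [Group H] (f : G →* H),
    Function.Surjective f → F.Mem G → F.Mem H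
  subdirect : ∀ {G A B : Type u} [Group G] [Group A] [Group B] (f : G →* A) (g : G →* B),
    Function.Surjective f → Function.Surjective g → Function.Injective (f.prod g) →
    F.Mem A → F.Mem B → F.Mem G

/-- `F` is closed under taking subgroups. -/
def IsSubgroupClosed (F : GroupClass.{u}) : Prop :=
  ∀ {G : Type u} [Group G] (H : Subgroup G), F.Mem G → F.Mem H

/-- The `F`-residual of `G`: the intersection of all normal subgroups `N` with `G ⧸ N ∈ F`.
If `F` is a formation and `G` is finite, it is the smallest such `N`. -/
def residual (F : GroupClass.{u}) (G : Type u) [Group G] : Subgroup G :=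
  sInf {N : Subgroup G | ∃ _ : N.Normal, F.Mem (G ⧸ N)}

/-- The `X`-radical of `G`: the product of all normal subgroups of `G` that belong to `X`. -/
def radical (X : GroupClass.{u}) (G : Type u) [Group G] : Subgroup G :=
  sSup {N : Subgroup G | N.Normal ∧ X.Mem N}

theorem residual_map_le (F : GroupClass.{u}) {G H : Type u} [Group G] [Group H] (e : G ≃* H) :
    (F.residual G).map (e : G →* H) ≤ F.residual H := by
  refine le_sInf ?_
  rintro N ⟨hN, hF⟩
  rw [Subgroup.map_le_iff_le_comap]
  refine sInf_le ⟨hN.comap _, ?_⟩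
  have hmap : (N.comap (e : G →* H)).map (e : G →* H) = N :=
    Subgroup.map_comap_eq_self_of_surjective e.surjective N
  exact F.iso (QuotientGroup.congr (N.comap (e : G →* H)) N e hmap).symm hF

theorem residual_map (F : GroupClass.{u}) {G H : Type u} [Group G] [Group H] (e : G ≃* H) :
    (F.residual G).map (e : G →* H) = F.residual H := by
  refine le_antisymm (F.residual_map_le e) ?_
  intro x hx
  exact ⟨e.symm x, F.residual_map_le e.symm ⟨x, hx, rfl⟩, e.apply_symm_apply x⟩

theorem radical_map_le (X : GroupClass.{u}) {G H : Type u} [Group G] [Group H] (e : G ≃* H) :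
    (X.radical G).map (e : G →* H) ≤ X.radical H := by
  rw [Subgroup.map_le_iff_le_comap]
  refine sSup_le ?_
  rintro N ⟨hN, hX⟩
  rw [← Subgroup.map_le_iff_le_comap]
  exact le_sSup ⟨hN.map _ e.surjective, X.iso (e.subgroupMap N) hX⟩

/-- The formation product `X ∘ F`: the finite groups whose `F`-residual belongs to `X`. -/
def prod (X F : GroupClass.{u}) : GroupClass.{u} where
  Mem G _ := Finite G ∧ X.Mem (F.residual G)
  finite h := h.1
  iso := by
    intro G H _ _ e h
    have := h.1
    refine ⟨Finite.of_equiv G e.toEquiv, ?_⟩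
    exact X.iso ((e.subgroupMap (F.residual G)).trans
      (MulEquiv.subgroupCongr (F.residual_map e))) h.2

/-- The class of finite nilpotent groups. -/
def nilpotentGroups : GroupClass.{u} where
  Mem G _ := Finite G ∧ Group.IsNilpotent G
  finite h := h.1
  iso := by
    intro G H _ _ e h
    have := h.1
    have := h.2
    exact ⟨Finite.of_equiv G e.toEquiv, Group.nilpotent_of_mulEquiv e⟩

/-- The class of finite `π`-groups. -/
def piGroups (π : Set Nat.Primes) : GroupClass.{u} where
  Mem G _ := Finite G ∧ ∀ p : Nat.Primes, (p : ℕ) ∣ Nat.card G → p ∈ π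
  finite h := h.1
  iso := by
    intro G H _ _ e h
    have := h.1
    refine ⟨Finite.of_equiv G e.toEquiv, ?_⟩
    rw [← Nat.card_congr e.toEquiv]
    exact h.2

/-- The class of finite `π`-nilpotent groups: finite groups with a normal `π'`-subgroup whose
quotient is nilpotent. -/
def piNilpotentGroups (π : Set Nat.Primes) : GroupClass.{u} where
  Mem G _ := Finite G ∧
    ∃ (N : Subgroup G) (_ : N.Normal), (piGroups πᶜ).Mem N ∧ Group.IsNilpotent (G ⧸ N)
  finite h := h.1
  iso := by
    rintro G H _ _ e ⟨hG, N, hN, h1, h2⟩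
    have hN' : (N.map (e : G →* H)).Normal := hN.map _ e.surjective
    exact ⟨Finite.of_equiv G e.toEquiv, N.map (e : G →* H), hN',
      (piGroups πᶜ).iso (e.subgroupMap N) h1,
      Group.nilpotent_of_mulEquiv (QuotientGroup.congr N (N.map (e : G →* H)) e rfl)⟩

end GroupClass

/-- `L / K` is a chief factor of `G`. -/
structure IsChiefFactor {G : Type u} [Group G] (K L : Subgroup G) : Prop where
  normal_bot : K.Normal
  normal_top : L.Normal
  lt : K < L
  eq_or_eq : ∀ M : Subgroup G, M.Normal → K ≤ M → M ≤ L → M = K ∨ M = L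

theorem IsChiefFactor.comap {G H : Type u} [Group G] [Group H] (e : G ≃* H) {K L : Subgroup H}
    (h : IsChiefFactor K L) : IsChiefFactor (K.comap (e : G →* H)) (L.comap (e : G →* H)) where
  normal_bot := h.normal_bot.comap _
  normal_top := h.normal_top.comap _
  lt := (Subgroup.comap_lt_comap_of_surjective e.surjective).2 h.lt
  eq_or_eq := by
    intro M hM hKM hML
    have hs : Function.Surjective (e : G →* H) := e.surjective
    have hcm : (M.map (e : G →* H)).comap (e : G →* H) = M :=
      Subgroup.comap_map_eq_self_of_injective e.injective M
    rcases h.eq_or_eq (M.map (e : G →* H)) (hM.map _ hs)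
      ((Subgroup.comap_le_comap_of_surjective hs).1 (hcm.symm ▸ hKM))
      (Subgroup.map_le_iff_le_comap.2 hML) with h1 | h1
    · left; rw [← h1, hcm]
    · right; rw [← h1, hcm]

namespace GroupClass

/-- The class of finite `π`-solvable groups: every chief factor is either a `p`-group for some
`p ∈ π` or a `π'`-group. -/
def piSolvableGroups (π : Set Nat.Primes) : GroupClass.{u} where
  Mem G _ := Finite G ∧ ∀ K L : Subgroup G, IsChiefFactor K L →
    (∃ p ∈ π, ∃ n : ℕ, K.relIndex L = (p : ℕ) ^ n) ∨ ∀ p ∈ π, ¬ (p : ℕ) ∣ K.relIndex L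
  finite h := h.1
  iso := by
    rintro G H _ _ e ⟨hG, h⟩
    refine ⟨Finite.of_equiv G e.toEquiv, fun K L hKL => ?_⟩
    have := h _ _ (hKL.comap e)
    rwa [Subgroup.relIndex_comap,
      Subgroup.map_comap_eq_self_of_surjective e.surjective] at this

/-- `G` is `S`-critical for `X`: `G` is a finite group outside `X` all of whose proper subgroups
belong to `X`. -/
def IsCritical (X : GroupClass.{u}) (G : Type u) [Group G] : Prop :=
  Finite G ∧ ¬ X.Mem G ∧ ∀ H : Subgroup G, H < ⊤ → X.Mem H

/-- The `π`-boundary condition (I): `Crit_S(F) ⊆ N_π ∘ F`. -/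
def BoundaryConditionI (π : Set Nat.Primes) (F : GroupClass.{u}) : Prop :=
  ∀ (G : Type u) [Group G], F.IsCritical G → ((piNilpotentGroups π).prod F).Mem G

/-- The `π`-boundary condition (II): `Crit_S(G_p ∘ F) ⊆ S_π ∘ F` for every `p ∈ π`. -/
def BoundaryConditionII (π : Set Nat.Primes) (F : GroupClass.{u}) : Prop :=
  ∀ p ∈ π, ∀ (G : Type u) [Group G],
    ((piGroups {p}).prod F).IsCritical G → ((piSolvableGroups π).prod F).Mem G

/-- The `X`-`F`-norm of `G`: the intersection over all subgroups `H` of `G` of the normalizers of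
the products of the `F`-residual of `H` with the (normal) `X`-radical of `G`. -/
def norm (X F : GroupClass.{u}) (G : Type u) [Group G] : Subgroup G :=
  ⨅ H : Subgroup G,
    Subgroup.normalizer (((F.residual H).map H.subtype ⊔ X.radical G : Subgroup G) : Set G)

theorem norm_map_le (X F : GroupClass.{u}) {G : Type u} [Group G] (e : G ≃* G) :
    (X.norm F G).map (e : G →* G) ≤ X.norm F G := by
  have key : ∀ H : Subgroup G,
      ((F.residual H).map H.subtype ⊔ X.radical G).map (e : G →* G) =
        (F.residual (H.map (e : G →* G))).map (H.map (e : G →* G)).subtype ⊔ X.radical G := by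
    intro H
    rw [Subgroup.map_sup]
    congr 1
    · have h := F.residual_map (e.subgroupMap H)
      calc ((F.residual H).map H.subtype).map (e : G →* G)
          = ((F.residual H).map (e.subgroupMap H : H →* H.map (e : G →* G))).map
              (H.map (e : G →* G)).subtype := by
            rw [Subgroup.map_map, Subgroup.map_map]; rfl
        _ = _ := congrArg _ h
    · refine le_antisymm (X.radical_map_le e) fun x hx => ?_
      exact ⟨e.symm x, X.radical_map_le e.symm ⟨x, hx, rfl⟩, e.apply_symm_apply x⟩
  refine le_iInf fun H => ?_
  have hH : (H.comap (e : G →* G)).map (e : G →* G) = H :=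
    Subgroup.map_comap_eq_self_of_surjective e.surjective H
  have h1 := key (H.comap (e : G →* G))
  rw [hH] at h1
  rw [← h1]
  exact (Subgroup.map_mono (iInf_le _ (H.comap (e : G →* G)))).trans
    (Subgroup.le_normalizer_map _)

instance norm_normal (X F : GroupClass.{u}) (G : Type u) [Group G] : (X.norm F G).Normal :=
  ⟨fun n hn g => X.norm_map_le F (MulAut.conj g) ⟨n, hn, rfl⟩⟩

/-- The `X`-`F`-norm series `N⁰ = 1`, `Nⁱ⁺¹ / Nⁱ = norm of G / Nⁱ`, bundled with normality. -/
def normSeriesAux (X F : GroupClass.{u}) (G : Type u) [Group G] :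
    ℕ → {N : Subgroup G // N.Normal}
  | 0 => ⟨⊥, inferInstance⟩
  | i + 1 =>
    let N := normSeriesAux X F G i
    haveI : N.1.Normal := N.2
    ⟨(X.norm F (G ⧸ N.1)).comap (QuotientGroup.mk' N.1), inferInstance⟩

/-- The `i`-th term of the `X`-`F`-norm series of `G`. -/
def normSeries (X F : GroupClass.{u}) (G : Type u) [Group G] (i : ℕ) : Subgroup G :=
  (normSeriesAux X F G i).1

/-- The terminal term of the `X`-`F`-norm series. The series is ascending, so for a finite group
it becomes stationary and its supremum is its terminal term. -/
def normInfty (X F : GroupClass.{u}) (G : Type u) [Group G] : Subgroup G :=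
  ⨆ i : ℕ, X.normSeries F G i

end GroupClass

/-- The action of `G` by conjugation on `L / K`, where `L / K` is the image of `L` in `G ⧸ K`
(for `K ≤ L`). Its kernel is the centralizer `C_G(L / K)`. -/
def factorAction {G : Type u} [Group G] (K L : Subgroup G) [K.Normal] [L.Normal] :
    G →* MulAut (L.map (QuotientGroup.mk' K)) :=
  haveI : (L.map (QuotientGroup.mk' K)).Normal :=
    Subgroup.Normal.map ‹_› _ (QuotientGroup.mk'_surjective K)
  MulAut.conjNormal.comp (QuotientGroup.mk' K)

namespace GroupClass

/-- The factor `L / K` is `F`-central in `G`: `(L / K) ⋊ (G / C_G(L / K)) ∈ F`. -/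
def IsCentralFactor (F : GroupClass.{u}) {G : Type u} [Group G] (K L : Subgroup G)
    [K.Normal] [L.Normal] : Prop :=
  F.Mem (L.map (QuotientGroup.mk' K) ⋊[QuotientGroup.kerLift (factorAction K L)]
    (G ⧸ (factorAction K L).ker))

/-- The normal subgroup `N` is `πF`-hypercentral in `G`: every chief factor of `G` below `N` of
order divisible by some prime in `π` is `F`-central in `G` (no condition if `N = 1`). -/
def IsHypercentral (π : Set Nat.Primes) (F : GroupClass.{u}) {G : Type u} [Group G]
    (N : Subgroup G) : Prop :=
  N.Normal ∧ ∀ (K L : Subgroup G) [K.Normal] [L.Normal], IsChiefFactor K L → L ≤ N →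
    (∃ p ∈ π, (p : ℕ) ∣ K.relIndex L) → F.IsCentralFactor K L

/-- The `πF`-hypercentre of `G`: the product of all `πF`-hypercentral normal subgroups. -/
def hypercentre (π : Set Nat.Primes) (F : GroupClass.{u}) (G : Type u) [Group G] : Subgroup G :=
  sSup {N : Subgroup G | IsHypercentral π F N}

/-- The equality of the terminal term of the `π'F`-norm series of `G` with the
`π(N ∘ F)`-hypercentre of `G`. -/
def NormEqHypercentre (π : Set Nat.Primes) (F : GroupClass.{u}) (G : Type u) [Group G] : Prop :=
  (piGroups πᶜ).normInfty F G = hypercentre π (nilpotentGroups.prod F) G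

end GroupClass

/-!
A normal subgroup `N` of `G` is `π(𝔑 ∘ 𝔉)`-hypercentral if and only if the residual `G^𝔉`
centralizes every chief factor of `G` below `N` whose order is divisible by a prime in `π`. With
this description the hypercentre always lies in `𝒩^∞`, so the two coincide for all groups once the
norm of every group is hypercentral.

In a counterexample `G` of least order the norm contains the unique minimal normal subgroup `L`
of `G`, the order of `L` is divisible by a prime in `π`, and `L` is not centralized by `G^𝔉`. Then
`G` is critical for `𝔊_p ∘ 𝔉` for some `p ∈ π` and `G^𝔉` is not `π`-solvable. If `L` is nonabelian,
this is because the residuals of the proper subgroups are trivial, while `L ≤ G^𝔉`. If `L` is a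
`p`-group, both `L` and its centralizer lie in the Frattini subgroup and the centralizer is a
`p`-group, so coprime action makes the residuals of the maximal subgroups `p`-groups. Were `G^𝔉`
`π`-solvable, a chief factor of `G` just above `G^𝔉 ∩ C_G(L)` would have order prime to `p`, hence
split off a normal subgroup that does not contain `L`.

Conversely, an `𝔉`-critical group equals its norm. When the norm is hypercentral, its residual
centralizes its own chief factors of order divisible by a prime in `π`, so it is `π`-nilpotent.
-/

section ChiefFactors

variable {G H : Type*} [Group G] [Group H]

theorem inf_sup_assoc_of_normal {A C : Subgroup G} (B : Subgroup G) [C.Normal] (h : C ≤ A) :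
    A ⊓ B ⊔ C = A ⊓ (B ⊔ C) := by
  apply SetLike.coe_injective
  rw [Subgroup.mul_normal, Subgroup.inf_mul_assoc A B C h, Subgroup.coe_inf, Subgroup.mul_normal]

theorem commutator_le_iff_le_comap_centralizer {D A K : Subgroup G} [K.Normal] :
    ⁅D, A⁆ ≤ K ↔ A ≤ (Subgroup.centralizer (D.map (QuotientGroup.mk' K) : Set (G ⧸ K))).comap
      (QuotientGroup.mk' K) := by
  rw [← Subgroup.map_le_iff_le_comap, ← Subgroup.commutator_eq_bot_iff_le_centralizer,
    ← Subgroup.map_commutator, Subgroup.commutator_comm, Subgroup.map_eq_bot_iff,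
    QuotientGroup.ker_mk']

theorem commutator_sup_le_iff {D A B K : Subgroup G} [K.Normal] :
    ⁅D, A ⊔ B⁆ ≤ K ↔ ⁅D, A⁆ ≤ K ∧ ⁅D, B⁆ ≤ K := by
  simp only [commutator_le_iff_le_comap_centralizer, sup_le_iff]

theorem commutator_le_inf_iff_sup {D A B : Subgroup G} [A.Normal] [B.Normal] :
    ⁅D, A⁆ ≤ A ⊓ B ↔ ⁅D, A ⊔ B⁆ ≤ B := by
  rw [commutator_sup_le_iff, le_inf_iff, and_iff_right (Subgroup.commutator_le_right D A),
    and_iff_left (Subgroup.commutator_le_right D B)]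

theorem relIndex_inf_eq_sup (A B : Subgroup G) [B.Normal] :
    (A ⊓ B).relIndex A = B.relIndex (A ⊔ B) := by
  rw [Subgroup.inf_relIndex_left, Subgroup.relIndex_sup_right]

theorem card_quotient_lt [Finite G] {N : Subgroup G} (h : N ≠ ⊥) :
    Nat.card (G ⧸ N) < Nat.card G := by
  rw [N.card_eq_card_quotient_mul_card_subgroup]
  exact lt_mul_of_one_lt_right Nat.card_pos (N.one_lt_card_iff_ne_bot.2 h)

theorem exists_isChiefFactor [Finite G] {K N : Subgroup G} [hK : K.Normal] [hN : N.Normal]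
    (h : K < N) : ∃ L, IsChiefFactor K L ∧ L ≤ N := by
  obtain ⟨L, hL⟩ := (Set.toFinite {L : Subgroup G | L.Normal ∧ K < L ∧ L ≤ N}).exists_minimal
    ⟨N, hN, h, le_rfl⟩
  obtain ⟨hLn, hKL, hLN⟩ := hL.prop
  refine ⟨L, ⟨hK, hLn, hKL, fun M hM hKM hML => ?_⟩, hLN⟩
  exact hKM.eq_or_lt.imp Eq.symm fun hlt =>
    hML.antisymm (hL.le_of_le ⟨hM, hlt, hML.trans hLN⟩ hML)

theorem isChiefFactor_inf_iff_sup {A B : Subgroup G} [hA : A.Normal] [hB : B.Normal] :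
    IsChiefFactor (A ⊓ B) A ↔ IsChiefFactor B (A ⊔ B) := by
  refine ⟨fun h => ⟨hB, inferInstance, ?_, fun M hM hBM hMAB => ?_⟩,
    fun h => ⟨inferInstance, hA, ?_, fun M hM hABM hMA => ?_⟩⟩
  · exact right_lt_sup.2 (inf_lt_left.1 h.lt)
  · have hMe : M ⊓ A ⊔ B = M := by rw [inf_sup_assoc_of_normal A hBM, inf_eq_left.2 hMAB]
    rcases h.eq_or_eq (M ⊓ A) inferInstance
      (le_inf (inf_le_right.trans hBM) inf_le_left) inf_le_right with hMA | hMA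
    · exact Or.inl (by rw [← hMe, hMA, sup_eq_right.2 inf_le_right])
    · exact Or.inr (by rw [← hMe, hMA])
  · exact inf_lt_left.2 (right_lt_sup.1 h.lt)
  · have hMe : A ⊓ (B ⊔ M) = M := by
      rw [← inf_sup_assoc_of_normal B hMA, sup_eq_right.2 hABM]
    rcases h.eq_or_eq (B ⊔ M) inferInstance le_sup_left
      (sup_le le_sup_right (hMA.trans le_sup_left)) with hBM | hBM
    · exact Or.inl (by rw [← hMe, hBM])
    · exact Or.inr (by rw [← hMe, hBM, inf_eq_left.2 le_sup_left])

theorem isChiefFactor_comap_iff {f : G →* H} (hf : Function.Surjective f) {K L : Subgroup H} :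
    IsChiefFactor (K.comap f) (L.comap f) ↔ IsChiefFactor K L := by
  have hmc (M : Subgroup H) : (M.comap f).map f = M := Subgroup.map_comap_eq_self_of_surjective hf M
  refine ⟨fun h => ⟨?_, ?_, ?_, fun M hM hKM hML => ?_⟩,
    fun h => ⟨h.normal_bot.comap f, h.normal_top.comap f, ?_, fun M hM hKM hML => ?_⟩⟩
  · exact hmc K ▸ h.normal_bot.map f hf
  · exact hmc L ▸ h.normal_top.map f hf
  · exact (Subgroup.comap_lt_comap_of_surjective hf).1 h.lt
  · exact (h.eq_or_eq (M.comap f) (hM.comap f) (Subgroup.comap_mono hKM)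
      (Subgroup.comap_mono hML)).imp (fun e => Subgroup.comap_injective hf e)
      fun e => Subgroup.comap_injective hf e
  · exact (Subgroup.comap_lt_comap_of_surjective hf).2 h.lt
  · have hcm : (M.map f).comap f = M :=
      Subgroup.comap_map_eq_self ((Subgroup.ker_le_comap f K).trans hKM)
    rw [← hcm] at hKM hML
    rw [Subgroup.comap_le_comap_of_surjective hf] at hKM hML
    exact (h.eq_or_eq (M.map f) (hM.map f hf) hKM hML).imp (fun e => by rw [← hcm, e])
      fun e => by rw [← hcm, e]

theorem IsChiefFactor.map {f : G →* H} (hf : Function.Surjective f) {K L : Subgroup G}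
    (h : IsChiefFactor K L) (hK : f.ker ≤ K) : IsChiefFactor (K.map f) (L.map f) := by
  rwa [← isChiefFactor_comap_iff hf, Subgroup.comap_map_eq_self hK,
    Subgroup.comap_map_eq_self (hK.trans h.lt.le)]

theorem IsChiefFactor.map_mk' {K L : Subgroup G} [K.Normal] (h : IsChiefFactor K L) :
    IsChiefFactor ⊥ (L.map (QuotientGroup.mk' K)) := by
  have := h.map (QuotientGroup.mk'_surjective K) (QuotientGroup.ker_mk' K).le
  rwa [(Subgroup.map_eq_bot_iff K).2 (QuotientGroup.ker_mk' K).ge] at this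

theorem card_map_mk' (K L : Subgroup G) [K.Normal] :
    Nat.card (L.map (QuotientGroup.mk' K)) = K.relIndex L := by
  rw [← Subgroup.relIndex_ker, QuotientGroup.ker_mk']

section MinimalNormal

variable {L M : Subgroup G}

theorem IsChiefFactor.ne_bot (h : IsChiefFactor ⊥ L) : L ≠ ⊥ := h.lt.ne'

theorem IsChiefFactor.le_or_inf_eq_bot (h : IsChiefFactor ⊥ L) [M.Normal] :
    L ≤ M ∨ L ⊓ M = ⊥ := by
  have := h.normal_top
  exact ((h.eq_or_eq (L ⊓ M) inferInstance bot_le inf_le_left).imp id inf_eq_left.1).symm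

theorem IsChiefFactor.commutator_eq_bot_of_isNilpotent (h : IsChiefFactor ⊥ L) [M.Normal]
    (hnil : Group.IsNilpotent M) : ⁅M, L⁆ = ⊥ := by
  have := h.normal_top
  rw [Subgroup.commutator_comm]
  refine (h.eq_or_eq ⁅L, M⁆ inferInstance bot_le (Subgroup.commutator_le_left _ _)).resolve_right
    fun hLM => ?_
  have hle (n : ℕ) : L ≤ M.lowerCentralSeries n := by
    induction n with
    | zero => exact hLM ▸ Subgroup.commutator_le_right L M
    | succ n ih => exact hLM.ge.trans (Subgroup.commutator_mono ih le_rfl)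
  obtain ⟨n, hn⟩ := (Subgroup.isNilpotent_iff_lowerCentralSeries M).1 hnil
  exact h.lt.not_ge (hn ▸ hle n)

end MinimalNormal

end ChiefFactors

section CentralizesPiFactors

variable {G H : Type*} [Group G] [Group H]

/-- `D` centralizes every chief factor `L / K` of `G` between `M` and `N` whose order is divisible
by a prime in `π`. For `M = ⊥` and `D` the residual of `G` this characterizes hypercentrality
of `N`. -/
def CentralizesPiFactors (π : Set Nat.Primes) (D M N : Subgroup G) : Prop :=
  ∀ K L : Subgroup G, IsChiefFactor K L → M ≤ K → L ≤ N →
    (∃ p ∈ π, (p : ℕ) ∣ K.relIndex L) → ⁅D, L⁆ ≤ K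

variable {π : Set Nat.Primes} {D A M N : Subgroup G}

theorem CentralizesPiFactors.mono {M' N' : Subgroup G} (h : CentralizesPiFactors π D M N)
    (hM : M ≤ M') (hN : N' ≤ N) : CentralizesPiFactors π D M' N' :=
  fun K L hKL hMK hLN => h K L hKL (hM.trans hMK) (hLN.trans hN)

theorem CentralizesPiFactors.commutator_le_of_inf_sup_eq (h : CentralizesPiFactors π D A N)
    {K L : Subgroup G} (hKL : IsChiefFactor K L) (hp : ∃ p ∈ π, (p : ℕ) ∣ K.relIndex L)
    [N.Normal] (hAN : A ≤ N) (hAK : A ≤ K) (hL : L ⊓ N ⊔ K = L) : ⁅D, L⁆ ≤ K := by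
  have := hKL.normal_bot
  have := hKL.normal_top
  have hchief : IsChiefFactor (L ⊓ N ⊓ K) (L ⊓ N) := by
    rwa [isChiefFactor_inf_iff_sup, hL]
  rw [← hL, ← commutator_le_inf_iff_sup]
  refine h _ _ hchief (le_inf (le_inf (hAK.trans hKL.lt.le) hAN) hAK) inf_le_right ?_
  rwa [relIndex_inf_eq_sup, hL]

theorem CentralizesPiFactors.commutator_le_of_inf_le (h : CentralizesPiFactors π D M N)
    {K L : Subgroup G} (hKL : IsChiefFactor K L) (hp : ∃ p ∈ π, (p : ℕ) ∣ K.relIndex L)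
    [M.Normal] (hMN : M ≤ N) (hLN : L ≤ N) (hL : L ⊓ M ≤ K) : ⁅D, L⁆ ≤ K := by
  have := hKL.normal_bot
  have := hKL.normal_top
  have hinf : L ⊓ (M ⊔ K) = K := by
    rw [← inf_sup_assoc_of_normal M hKL.lt.le, sup_eq_right.2 hL]
  have hchief : IsChiefFactor (M ⊔ K) (L ⊔ (M ⊔ K)) := by
    rwa [← isChiefFactor_inf_iff_sup, hinf]
  refine le_of_le_of_eq (commutator_le_inf_iff_sup.2 (h _ _ hchief le_sup_left ?_ ?_)) hinf
  · exact sup_le hLN (sup_le hMN (hKL.lt.le.trans hLN))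
  · rwa [← relIndex_inf_eq_sup, hinf]

theorem CentralizesPiFactors.trans [hM : M.Normal] (hAM : A ≤ M) (hMN : M ≤ N)
    (h₁ : CentralizesPiFactors π D A M) (h₂ : CentralizesPiFactors π D M N) :
    CentralizesPiFactors π D A N := by
  intro K L hKL hAK hLN hp
  have := hKL.normal_bot
  have := hKL.normal_top
  rcases hKL.eq_or_eq (L ⊓ M ⊔ K) inferInstance le_sup_right (sup_le inf_le_left hKL.lt.le)
    with h | h
  · exact h₂.commutator_le_of_inf_le hKL hp hMN hLN (sup_eq_right.1 h)
  · exact h₁.commutator_le_of_inf_sup_eq hKL hp hAM hAK h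

theorem centralizesPiFactors_sup_iff [M.Normal] [N.Normal] :
    CentralizesPiFactors π D M (N ⊔ M) ↔ CentralizesPiFactors π D (N ⊓ M) N := by
  refine ⟨fun h K L hKL hK hL hp => ?_, fun h K L hKL hMK hL hp => ?_⟩
  · exact h.commutator_le_of_inf_le hKL hp le_sup_right (hL.trans le_sup_left)
      ((inf_le_inf_right M hL).trans hK)
  · have := hKL.normal_bot
    refine h.commutator_le_of_inf_sup_eq hKL hp inf_le_left (inf_le_right.trans hMK) ?_
    rw [inf_sup_assoc_of_normal N hKL.lt.le, inf_eq_left.2 (hL.trans (sup_le_sup_left hMK N))]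

theorem CentralizesPiFactors.sup [M.Normal] [N.Normal]
    (h₁ : CentralizesPiFactors π D ⊥ M) (h₂ : CentralizesPiFactors π D ⊥ N) :
    CentralizesPiFactors π D ⊥ (N ⊔ M) :=
  h₁.trans bot_le le_sup_right (centralizesPiFactors_sup_iff.2 (h₂.mono bot_le le_rfl))

theorem centralizesPiFactors_comap_iff {f : G →* H} (hf : Function.Surjective f)
    {M N : Subgroup H} :
    CentralizesPiFactors π D (M.comap f) (N.comap f) ↔ CentralizesPiFactors π (D.map f) M N := by
  have hcomm (K L : Subgroup H) : ⁅D, L.comap f⁆ ≤ K.comap f ↔ ⁅D.map f, L⁆ ≤ K := by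
    rw [← Subgroup.map_le_iff_le_comap, Subgroup.map_commutator,
      Subgroup.map_comap_eq_self_of_surjective hf]
  have hindex (K L : Subgroup H) : (K.comap f).relIndex (L.comap f) = K.relIndex L := by
    rw [Subgroup.relIndex_comap, Subgroup.map_comap_eq_self_of_surjective hf]
  refine ⟨fun h K L hKL hMK hLN hp => ?_, fun h K L hKL hMK hLN hp => ?_⟩
  · exact (hcomm K L).1 (h _ _ ((isChiefFactor_comap_iff hf).2 hKL) (Subgroup.comap_mono hMK)
      (Subgroup.comap_mono hLN) (by rwa [hindex]))
  · have hK : f.ker ≤ K := (Subgroup.ker_le_comap f M).trans hMK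
    obtain ⟨X, rfl⟩ : ∃ X : Subgroup H, X.comap f = K := ⟨_, Subgroup.comap_map_eq_self hK⟩
    obtain ⟨Y, rfl⟩ : ∃ Y : Subgroup H, Y.comap f = L :=
      ⟨_, Subgroup.comap_map_eq_self (hK.trans hKL.lt.le)⟩
    rw [Subgroup.comap_le_comap_of_surjective hf] at hMK hLN
    rw [hindex] at hp
    exact (hcomm _ _).2 (h _ _ ((isChiefFactor_comap_iff hf).1 hKL) hMK hLN hp)

theorem IsChiefFactor.centralizesPiFactors {L : Subgroup G} (hL : IsChiefFactor ⊥ L)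
    (h : (∃ p ∈ π, (p : ℕ) ∣ Nat.card L) → ⁅D, L⁆ = ⊥) : CentralizesPiFactors π D ⊥ L := by
  rintro K X hKX - hXL ⟨p, hp, hdvd⟩
  have hX : X = L := (hL.eq_or_eq X hKX.normal_top bot_le hXL).resolve_left
    (bot_le.trans_lt hKX.lt).ne'
  subst hX
  exact (h ⟨p, hp, hdvd.trans (Subgroup.relIndex_dvd_card K X)⟩).le.trans bot_le

theorem exists_isChiefFactor_of_not_centralizesPiFactors [Finite G] [N.Normal]
    (hN : ¬ CentralizesPiFactors π D ⊥ N)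
    (hquot : ∀ X : Subgroup G, X.Normal → X ≠ ⊥ → CentralizesPiFactors π D X (N ⊔ X)) :
    ∃ L, IsChiefFactor ⊥ L ∧ L ≤ N ∧ (∀ X : Subgroup G, X.Normal → X ≠ ⊥ → L ≤ X) ∧
      (∃ p ∈ π, (p : ℕ) ∣ Nat.card L) ∧ ⁅D, L⁆ ≠ ⊥ := by
  have hN0 : N ≠ ⊥ := fun h => hN fun K L hKL _ hL _ => absurd (hL.trans (h.le.trans bot_le))
    hKL.lt.not_ge
  obtain ⟨L, hL, hLN⟩ := exists_isChiefFactor (bot_lt_iff_ne_bot.2 hN0)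
  have := hL.normal_top
  have hnc : ¬ CentralizesPiFactors π D ⊥ L := fun h =>
    hN (h.trans bot_le hLN ((hquot L this hL.ne_bot).mono le_rfl le_sup_left))
  refine ⟨L, hL, hLN, fun X _ hX0 => hL.le_or_inf_eq_bot.resolve_right fun hLX => hnc ?_,
    Classical.not_imp.1 (mt hL.centralizesPiFactors hnc)⟩
  rw [← hLX, ← centralizesPiFactors_sup_iff]
  exact (hquot X ‹_› hX0).mono le_rfl (sup_le_sup_right hLN X)

end CentralizesPiFactors

instance fact_prime_coe (p : Nat.Primes) : Fact (p : ℕ).Prime := ⟨p.2⟩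

namespace GroupClass

section Residual

variable {F : GroupClass.{u}} {G H : Type u} [Group G] [Group H]

theorem IsFormation.mem_of_subsingleton (hF : F.IsFormation) [Subsingleton G] : F.Mem G := by
  obtain ⟨H, _, hH⟩ := hF.nonempty
  exact hF.image (1 : H →* G) (fun x => ⟨1, Subsingleton.elim _ _⟩) hH

theorem IsFormation.mem_quotient_inf (hF : F.IsFormation) {M N : Subgroup G} [M.Normal] [N.Normal]
    (hM : F.Mem (G ⧸ M)) (hN : F.Mem (G ⧸ N)) : F.Mem (G ⧸ (M ⊓ N)) := by
  refine hF.subdirect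
    (QuotientGroup.map (M ⊓ N) M (MonoidHom.id G) inf_le_left)
    (QuotientGroup.map (M ⊓ N) N (MonoidHom.id G) inf_le_right) ?_ ?_ ?_ hM hN
  · exact fun x => (QuotientGroup.mk_surjective x).imp' QuotientGroup.mk fun _ h => h
  · exact fun x => (QuotientGroup.mk_surjective x).imp' QuotientGroup.mk fun _ h => h
  · rw [injective_iff_map_eq_one]
    intro x hx
    obtain ⟨g, rfl⟩ := QuotientGroup.mk_surjective x
    have hMN := Prod.ext_iff.1 hx
    exact (QuotientGroup.eq_one_iff _).2
      ⟨(QuotientGroup.eq_one_iff g).1 hMN.1, (QuotientGroup.eq_one_iff g).1 hMN.2⟩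

instance residual_normal : (F.residual G).Normal :=
  ⟨fun n hn g => F.residual_map_le (MulAut.conj g) ⟨n, hn, rfl⟩⟩

theorem IsFormation.mem_quotient_residual (hF : F.IsFormation) [Finite G] :
    F.Mem (G ⧸ F.residual G) := by
  have hinf : InfClosed {N : Subgroup G | ∃ _ : N.Normal, F.Mem (G ⧸ N)} := by
    rintro M ⟨_, hM⟩ N ⟨_, hN⟩
    exact ⟨inferInstance, hF.mem_quotient_inf hM hN⟩
  have := QuotientGroup.subsingleton_quotient_top (G := G)
  obtain ⟨_, h⟩ := hinf.sInf_mem (Set.toFinite _) ⟨inferInstance, hF.mem_of_subsingleton⟩ subset_rfl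
  exact h

theorem residual_le {N : Subgroup G} [hN : N.Normal] (h : F.Mem (G ⧸ N)) : F.residual G ≤ N :=
  sInf_le ⟨hN, h⟩

theorem IsFormation.mem_iff_residual_le_ker (hF : F.IsFormation) [Finite G] {f : G →* H}
    (hf : Function.Surjective f) : F.Mem H ↔ F.residual G ≤ f.ker :=
  ⟨fun h => residual_le (F.iso (QuotientGroup.quotientKerEquivOfSurjective f hf).symm h),
    fun h => hF.image (QuotientGroup.lift (F.residual G) f h)
      (fun y => (hf y).imp' QuotientGroup.mk fun _ h => h) hF.mem_quotient_residual⟩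

theorem IsFormation.mem_range_iff_residual_le_ker (hF : F.IsFormation) [Finite G] {f : G →* H} :
    F.Mem f.range ↔ F.residual G ≤ f.ker := by
  rw [hF.mem_iff_residual_le_ker f.rangeRestrict_surjective, MonoidHom.ker_rangeRestrict]

theorem IsFormation.residual_eq_bot_iff (hF : F.IsFormation) [Finite G] :
    F.residual G = ⊥ ↔ F.Mem G := by
  rw [eq_bot_iff, ← (MonoidHom.id G).ker_eq_bot_iff.2 Function.injective_id]
  exact (hF.mem_iff_residual_le_ker Function.surjective_id).symm

theorem IsFormation.map_residual (hF : F.IsFormation) [Finite G] {f : G →* H}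
    (hf : Function.Surjective f) : (F.residual G).map f = F.residual H := by
  have : Finite H := Finite.of_surjective f hf
  apply le_antisymm
  · rw [Subgroup.map_le_iff_le_comap]
    have h := (hF.mem_iff_residual_le_ker (f := (QuotientGroup.mk' (F.residual H)).comp f)
      ((QuotientGroup.mk'_surjective _).comp hf)).1 hF.mem_quotient_residual
    rwa [← MonoidHom.comap_ker, QuotientGroup.ker_mk'] at h
  · have : ((F.residual G).map f).Normal := residual_normal.map f hf
    refine residual_le ((hF.mem_iff_residual_le_ker
      (f := (QuotientGroup.mk' ((F.residual G).map f)).comp f)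
      ((QuotientGroup.mk'_surjective _).comp hf)).2 ?_)
    rw [← MonoidHom.comap_ker, QuotientGroup.ker_mk']
    exact Subgroup.le_comap_map _ _

variable (F) in
/-- The `F`-residual `H^F` of the subgroup `H`, as a subgroup of the ambient group; these are the
subgroups whose normalizers define the norm. -/
def subgroupResidual (H : Subgroup G) : Subgroup G := (F.residual H).map H.subtype

theorem subgroupResidual_le (H : Subgroup G) : F.subgroupResidual H ≤ H :=
  Subgroup.map_subtype_le _

theorem IsFormation.map_subgroupResidual (hF : F.IsFormation) [Finite G] (f : G →* H)
    (K : Subgroup G) : (F.subgroupResidual K).map f = F.subgroupResidual (K.map f) := by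
  rw [subgroupResidual, subgroupResidual, ← hF.map_residual (f.subgroupMap_surjective K),
    Subgroup.map_map, Subgroup.map_map]
  rfl

theorem IsFormation.subgroupResidual_top (hF : F.IsFormation) [Finite G] :
    F.subgroupResidual (⊤ : Subgroup G) = F.residual G :=
  hF.map_residual fun x => ⟨⟨x, trivial⟩, rfl⟩

theorem IsFormation.subgroupResidual_le_residual (hF : F.IsFormation) (hS : F.IsSubgroupClosed)
    [Finite G] (K : Subgroup G) : F.subgroupResidual K ≤ F.residual G := by
  rw [subgroupResidual, Subgroup.map_le_iff_le_comap]
  let f := (QuotientGroup.mk' (F.residual G)).comp K.subtype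
  have h := hF.mem_range_iff_residual_le_ker.1 (hS f.range hF.mem_quotient_residual)
  rwa [← MonoidHom.comap_ker, QuotientGroup.ker_mk'] at h

theorem IsFormation.subgroupResidual_mono (hF : F.IsFormation) (hS : F.IsSubgroupClosed)
    [Finite G] {K M : Subgroup G} (h : K ≤ M) : F.subgroupResidual K ≤ F.subgroupResidual M := by
  have hKM := Subgroup.map_mono (f := M.subtype)
    (hF.subgroupResidual_le_residual hS (K.subgroupOf M))
  rwa [hF.map_subgroupResidual, Subgroup.map_subgroupOf_eq_of_le h] at hKM

theorem IsFormation.normalizer_le_normalizer_subgroupResidual (hF : F.IsFormation) [Finite G]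
    (K : Subgroup G) :
    Subgroup.normalizer (K : Set G) ≤ Subgroup.normalizer (F.subgroupResidual K : Set G) := by
  intro g hg
  rw [Subgroup.mem_normalizer_iff_map_conj_eq] at hg ⊢
  rw [hF.map_subgroupResidual, hg]

theorem IsFormation.subgroupResidual_eq_bot_iff (hF : F.IsFormation) [Finite G]
    (K : Subgroup G) : F.subgroupResidual K = ⊥ ↔ F.Mem K := by
  rw [subgroupResidual, Subgroup.map_eq_bot_iff_of_injective _ K.subtype_injective,
    hF.residual_eq_bot_iff]

theorem mem_subgroupResidual_iff (X : GroupClass.{u}) (K : Subgroup G) :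
    X.Mem (F.subgroupResidual K) ↔ X.Mem (F.residual K) :=
  let e := (F.residual K).equivMapOfInjective K.subtype K.subtype_injective
  ⟨X.iso e.symm, X.iso e⟩

end Residual

section PiGroups

variable {π σ : Set Nat.Primes} {G H : Type u} [Group G] [Group H]

theorem piGroups_mem_iff [Finite G] :
    (piGroups σ).Mem G ↔ ∀ p : Nat.Primes, (p : ℕ) ∣ Nat.card G → p ∈ σ :=
  ⟨fun h => h.2, fun h => ⟨‹_›, h⟩⟩

theorem piGroups_compl_mem_iff [Finite G] :
    (piGroups πᶜ).Mem G ↔ ∀ p ∈ π, ¬ (p : ℕ) ∣ Nat.card G := by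
  rw [piGroups_mem_iff]
  exact forall_congr' fun p => imp_not_comm

theorem piGroups_singleton_mem_iff [Finite G] {p : Nat.Primes} :
    (piGroups {p}).Mem G ↔ IsPGroup p G := by
  rw [piGroups_mem_iff, IsPGroup.iff_card]
  constructor
  · exact fun h => ⟨_, Nat.eq_prime_pow_of_unique_prime_dvd Nat.card_pos.ne' fun {q} hq hd =>
      congrArg Subtype.val (h ⟨q, hq⟩ hd)⟩
  · rintro ⟨n, hn⟩ q hq
    exact Subtype.ext ((Nat.prime_dvd_prime_iff_eq q.2 p.2).1 (q.2.dvd_of_dvd_pow (hn ▸ hq)))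

theorem piGroups_mem_of_card_dvd [Finite H] (h : Nat.card H ∣ Nat.card G)
    (hG : (piGroups σ).Mem G) : (piGroups σ).Mem H :=
  ⟨‹_›, fun p hp => hG.2 p (hp.trans h)⟩

theorem piGroups_mem_of_le [Finite G] {M N : Subgroup G} (hMN : M ≤ N) (hN : (piGroups σ).Mem N) :
    (piGroups σ).Mem M :=
  piGroups_mem_of_card_dvd (Subgroup.card_dvd_of_le hMN) hN

theorem piGroups_mem_bot : (piGroups σ).Mem (⊥ : Subgroup G) :=
  ⟨inferInstance, fun p hp => absurd hp (by simpa using p.2.one_lt.ne')⟩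

theorem piGroups_mem_sup [Finite G] {M N : Subgroup G} [N.Normal] (hM : (piGroups σ).Mem M)
    (hN : (piGroups σ).Mem N) : (piGroups σ).Mem (M ⊔ N : Subgroup G) := by
  refine ⟨inferInstance, fun p hp => ?_⟩
  rw [← Subgroup.relIndex_bot_left, ← Subgroup.relIndex_mul_relIndex ⊥ N _ bot_le le_sup_right,
    Subgroup.relIndex_bot_left, Subgroup.relIndex_sup_right, mul_comm] at hp
  exact (p.2.dvd_mul.1 hp).elim (fun h => hM.2 p (h.trans (N.relIndex_dvd_card M))) (hN.2 p)

instance radical_characteristic (X : GroupClass.{u}) : (X.radical G).Characteristic :=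
  Subgroup.characteristic_iff_map_le.2 X.radical_map_le

theorem le_radical {X : GroupClass.{u}} {N : Subgroup G} [hN : N.Normal] (h : X.Mem N) :
    N ≤ X.radical G := le_sSup ⟨hN, h⟩

theorem piGroups_mem_radical [Finite G] : (piGroups σ).Mem ((piGroups σ).radical G) := by
  have hsup : SupClosed {N : Subgroup G | N.Normal ∧ (piGroups σ).Mem N} := by
    rintro M ⟨_, hM⟩ N ⟨_, hN⟩
    exact ⟨inferInstance, piGroups_mem_sup hM hN⟩
  exact (hsup.sSup_mem (Set.toFinite _) ⟨inferInstance, piGroups_mem_bot⟩ subset_rfl).2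

-- The `σ`-radical of `L` is characteristic in `L`, hence normal in `G`.
theorem piGroups_mem_of_isChiefFactor [Finite G] {L X : Subgroup G} (hL : IsChiefFactor ⊥ L)
    (hXL : X ≤ L) (hX : X ≠ ⊥) (hLX : L ≤ Subgroup.normalizer (X : Set G))
    (hσ : (piGroups σ).Mem X) : (piGroups σ).Mem L := by
  have := hL.normal_top
  have := (Subgroup.normal_subgroupOf_iff_le_normalizer hXL).2 hLX
  let R := ((piGroups σ).radical L).map L.subtype
  have hXR : X ≤ R := by
    rw [← Subgroup.map_subgroupOf_eq_of_le hXL]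
    exact Subgroup.map_mono
      (le_radical ((piGroups σ).iso (Subgroup.subgroupOfEquivOfLe hXL).symm hσ))
  have hRL : R = L := (hL.eq_or_eq R ConjAct.normal_of_characteristic_of_normal bot_le
    (Subgroup.map_subtype_le _)).resolve_left fun h => hX (eq_bot_iff.2 (hXR.trans h.le))
  rw [← hRL]
  exact (piGroups σ).iso (Subgroup.equivMapOfInjective _ _ L.subtype_injective)
    piGroups_mem_radical

theorem exists_isChiefFactor_subgroupOf [Finite G] {L M : Subgroup G} (hL : IsChiefFactor ⊥ L)
    (hLM : L ≤ M) : ∃ X : Subgroup M, IsChiefFactor ⊥ X ∧ X ≤ L.subgroupOf M := by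
  have := hL.normal_top
  refine exists_isChiefFactor (bot_lt_iff_ne_bot.2 fun h => hL.ne_bot ?_)
  rw [← Subgroup.map_subgroupOf_eq_of_le hLM, h, Subgroup.map_bot]

theorem piGroups_mem_of_isChiefFactor_subgroupOf [Finite G] {L M : Subgroup G}
    (hL : IsChiefFactor ⊥ L) (hLM : L ≤ M) {X : Subgroup M} (hX : IsChiefFactor ⊥ X)
    (hXL : X ≤ L.subgroupOf M) (hσ : (piGroups σ).Mem X) : (piGroups σ).Mem L := by
  have hnorm := Subgroup.le_normalizer_map (H := X) M.subtype
  rw [Subgroup.normalizer_eq_top_iff.2 hX.normal_top, ← MonoidHom.range_eq_map,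
    Subgroup.range_subtype] at hnorm
  refine piGroups_mem_of_isChiefFactor hL (Subgroup.map_le_iff_le_comap.2 hXL) ?_
    (hLM.trans hnorm) ((piGroups σ).iso (X.equivMapOfInjective _ M.subtype_injective) hσ)
  exact fun h => hX.ne_bot ((Subgroup.map_eq_bot_iff_of_injective _ M.subtype_injective).1 h)

theorem commutator_self_eq_bot_of_isPGroup [Finite G] {L : Subgroup G} (hL : IsChiefFactor ⊥ L)
    {p : ℕ} [Fact p.Prime] (h : IsPGroup p L) : ⁅L, L⁆ = ⊥ :=
  have := hL.normal_top
  hL.commutator_eq_bot_of_isNilpotent h.isNilpotent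

theorem isPGroup_of_commutator_self_eq_bot [Finite G] {L : Subgroup G} (hL : IsChiefFactor ⊥ L)
    {p : Nat.Primes} (hp : (p : ℕ) ∣ Nat.card L) (h : ⁅L, L⁆ = ⊥) : IsPGroup p L := by
  obtain ⟨x, hx⟩ := exists_prime_orderOf_dvd_card' (p : ℕ) hp
  have hxL : Subgroup.zpowers (x : G) ≤ L := Subgroup.zpowers_le.2 x.2
  have hcard : Nat.card (Subgroup.zpowers (x : G)) = p := by
    rw [Nat.card_zpowers, Subgroup.orderOf_coe, hx]
  rw [← piGroups_singleton_mem_iff]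
  refine piGroups_mem_of_isChiefFactor hL hxL ?_ ?_ ?_
  · exact (Subgroup.one_lt_card_iff_ne_bot _).1 (hcard ▸ p.2.one_lt)
  · rw [Subgroup.commutator_eq_bot_iff_le_centralizer] at h
    exact h.trans ((Subgroup.centralizer_le hxL).trans (Subgroup.centralizer_le_normalizer _))
  · rw [piGroups_singleton_mem_iff, IsPGroup.iff_card]
    exact ⟨1, by rw [hcard, pow_one]⟩

end PiGroups

section PiSolvable

variable {π : Set Nat.Primes} {G H : Type u} [Group G] [Group H]

theorem piSolvableGroups_mem_of_surjective {f : G →* H} (hf : Function.Surjective f)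
    (hG : (piSolvableGroups π).Mem G) : (piSolvableGroups π).Mem H := by
  have := hG.1
  refine ⟨Finite.of_surjective f hf, fun K L hKL => ?_⟩
  have := hG.2 _ _ ((isChiefFactor_comap_iff hf).2 hKL)
  rwa [Subgroup.relIndex_comap, Subgroup.map_comap_eq_self_of_surjective hf] at this

theorem mem_piGroups_of_mem_piSolvableGroups [Finite G] {L D : Subgroup G}
    (hL : IsChiefFactor ⊥ L) (hLD : L ≤ D) (hD : (piSolvableGroups π).Mem D) :
    (∃ p ∈ π, (piGroups {p}).Mem L) ∨ (piGroups πᶜ).Mem L := by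
  obtain ⟨X, hX, hXL⟩ := exists_isChiefFactor_subgroupOf hL hLD
  have hLσ {σ : Set Nat.Primes} (h : (piGroups σ).Mem X) : (piGroups σ).Mem L :=
    piGroups_mem_of_isChiefFactor_subgroupOf hL hLD hX hXL h
  have hX' := hD.2 ⊥ X hX
  rw [Subgroup.relIndex_bot_left] at hX'
  rcases hX' with ⟨p, hp, hpow⟩ | hcoprime
  · exact Or.inl ⟨p, hp, hLσ (piGroups_singleton_mem_iff.2 (IsPGroup.iff_card.2 hpow))⟩
  · exact Or.inr (hLσ (piGroups_compl_mem_iff.2 hcoprime))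

theorem relIndex_of_mem_piSolvableGroups [Finite G] {K L D : Subgroup G} (hKL : IsChiefFactor K L)
    (hLD : L ≤ D) (hD : (piSolvableGroups π).Mem D) :
    (∃ p ∈ π, ∃ n : ℕ, K.relIndex L = (p : ℕ) ^ n) ∨ ∀ p ∈ π, ¬ (p : ℕ) ∣ K.relIndex L := by
  have := hKL.normal_bot
  rw [← card_map_mk' K L]
  refine (mem_piGroups_of_mem_piSolvableGroups hKL.map_mk' (Subgroup.map_mono hLD)
    (piSolvableGroups_mem_of_surjective ((QuotientGroup.mk' K).subgroupMap_surjective D) hD)).imp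
    ?_ piGroups_compl_mem_iff.1
  exact fun ⟨p, hp, hL⟩ => ⟨p, hp, IsPGroup.iff_card.1 (piGroups_singleton_mem_iff.1 hL)⟩

end PiSolvable

end GroupClass

namespace GroupClass

section CentralFactor

variable {F : GroupClass.{u}} {G V A : Type u} [Group G] [Group V] [Group A]

/-- The conjugation action of the semidirect product `V ⋊[φ] A` on its normal subgroup `V`, with
values in the automorphisms of `V`; its kernel is the centralizer of `V`. -/
def semidirectAction (φ : A →* MulAut V) : V ⋊[φ] A →* MulAut V :=
  SemidirectProduct.lift MulAut.conj φ fun a => by ext v w; simp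

variable {φ : A →* MulAut V}

theorem range_semidirectAction (hφ : (MulAut.conj : V →* MulAut V).range ≤ φ.range) :
    (semidirectAction φ).range = φ.range := by
  apply le_antisymm
  · rintro _ ⟨x, rfl⟩
    exact φ.range.mul_mem (hφ ⟨x.left, rfl⟩) ⟨x.right, rfl⟩
  · rintro _ ⟨a, rfl⟩
    exact ⟨SemidirectProduct.inr a, by simp [semidirectAction]⟩

theorem inl_semidirectAction (x : V ⋊[φ] A) (v : V) :
    SemidirectProduct.inl (semidirectAction φ x v) = x * SemidirectProduct.inl v * x⁻¹ := by
  ext <;> simp [semidirectAction, SemidirectProduct.lift]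

theorem ker_semidirectAction : (semidirectAction φ).ker =
    Subgroup.centralizer ((SemidirectProduct.inl : V →* V ⋊[φ] A).range : Set (V ⋊[φ] A)) := by
  ext x
  simp only [MonoidHom.mem_ker, MulEquiv.ext_iff, MulAut.one_apply, Subgroup.mem_centralizer_iff,
    SetLike.mem_coe, MonoidHom.mem_range, forall_exists_index, forall_apply_eq_imp_iff]
  refine forall_congr' fun v => ?_
  rw [← (SemidirectProduct.inl_injective (φ := φ)).eq_iff, inl_semidirectAction,
    mul_inv_eq_iff_eq_mul, eq_comm]

theorem isChiefFactor_range_inl [Nontrivial V]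
    (hirr : ∀ S : Subgroup V, (∀ a, ∀ v ∈ S, φ a v ∈ S) → S = ⊥ ∨ S = ⊤) :
    IsChiefFactor ⊥ (SemidirectProduct.inl : V →* V ⋊[φ] A).range where
  normal_bot := inferInstance
  normal_top := by rw [SemidirectProduct.range_inl_eq_ker_rightHom]; infer_instance
  lt := by
    rw [bot_lt_iff_ne_bot, MonoidHom.range_eq_map, Ne,
      Subgroup.map_eq_bot_iff_of_injective _ SemidirectProduct.inl_injective]
    exact top_ne_bot
  eq_or_eq := by
    intro M hM _ hMV
    rw [← Subgroup.map_comap_eq_self hMV, MonoidHom.range_eq_map]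
    refine (hirr (M.comap SemidirectProduct.inl) fun a v hv => ?_).imp
      (fun h => by rw [h, Subgroup.map_bot]) fun h => by rw [h]
    rw [Subgroup.mem_comap, SemidirectProduct.inl_aut, map_inv]
    exact hM.conj_mem _ hv _

theorem isNilpotent_of_commutator_self_eq_bot {R : Subgroup G} (h : ⁅R, R⁆ = ⊥) :
    Group.IsNilpotent R :=
  (Subgroup.isNilpotent_iff_lowerCentralSeries R).2
    ⟨1, by rwa [Subgroup.lowerCentralSeries_succ, Subgroup.lowerCentralSeries_zero]⟩

theorem nilpotentGroups_prod_mem_semidirectProduct_iff (hF : F.IsFormation) [Finite V] [Finite A]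
    (hinj : Function.Injective φ) (hφ : (MulAut.conj : V →* MulAut V).range ≤ φ.range)
    (hV : IsChiefFactor ⊥ (SemidirectProduct.inl : V →* V ⋊[φ] A).range) :
    (nilpotentGroups.prod F).Mem (V ⋊[φ] A) ↔ F.Mem A := by
  have hfin : Finite (V ⋊[φ] A) := Finite.of_equiv _ SemidirectProduct.equivProd.symm
  have hcomm : F.Mem A ↔
      ⁅F.residual (V ⋊[φ] A), (SemidirectProduct.inl : V →* V ⋊[φ] A).range⁆ = ⊥ := by
    rw [Subgroup.commutator_eq_bot_iff_le_centralizer, ← ker_semidirectAction,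
      ← hF.mem_range_iff_residual_le_ker, range_semidirectAction hφ]
    exact ⟨F.iso (φ.ofInjective hinj), F.iso (φ.ofInjective hinj).symm⟩
  refine ⟨fun h => hcomm.2 (hV.commutator_eq_bot_of_isNilpotent h.2.2), fun h => ?_⟩
  have hle : F.residual (V ⋊[φ] A) ≤ (SemidirectProduct.inl : V →* V ⋊[φ] A).range := by
    rw [SemidirectProduct.range_inl_eq_ker_rightHom]
    exact (hF.mem_iff_residual_le_ker SemidirectProduct.rightHom_surjective).1 h
  exact ⟨hfin, inferInstance, isNilpotent_of_commutator_self_eq_bot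
    (eq_bot_iff.2 ((Subgroup.commutator_mono le_rfl hle).trans (hcomm.1 h).le))⟩

variable {K L : Subgroup G} [K.Normal] [L.Normal]

theorem ker_factorAction : (factorAction K L).ker =
    (Subgroup.centralizer (L.map (QuotientGroup.mk' K) : Set (G ⧸ K))).comap
      (QuotientGroup.mk' K) := by
  ext g
  simp only [MonoidHom.mem_ker, MulEquiv.ext_iff, MulAut.one_apply, Subgroup.mem_comap,
    Subgroup.mem_centralizer_iff, SetLike.mem_coe, Subtype.forall, Subtype.ext_iff]
  refine forall₂_congr fun x _ => ?_
  exact mul_inv_eq_iff_eq_mul.trans eq_comm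

theorem le_ker_factorAction_iff {D : Subgroup G} :
    D ≤ (factorAction K L).ker ↔ ⁅D, L⁆ ≤ K := by
  rw [Subgroup.commutator_comm, commutator_le_iff_le_comap_centralizer, ker_factorAction]

theorem range_conj_le_range_kerLift_factorAction :
    (MulAut.conj : L.map (QuotientGroup.mk' K) →* _).range ≤
      (QuotientGroup.kerLift (factorAction K L)).range := by
  rintro _ ⟨⟨_, l, hl, rfl⟩, rfl⟩
  exact ⟨(l : G ⧸ (factorAction K L).ker), by ext x; rfl⟩

theorem _root_.IsChiefFactor.eq_bot_or_eq_top_of_factorAction_mem (h : IsChiefFactor K L)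
    (S : Subgroup (L.map (QuotientGroup.mk' K))) (hS : ∀ g, ∀ v ∈ S, factorAction K L g v ∈ S) :
    S = ⊥ ∨ S = ⊤ := by
  let ι := (L.map (QuotientGroup.mk' K)).subtype
  have hι : Function.Injective ι := Subgroup.subtype_injective _
  have hnormal : (S.map ι).Normal := by
    refine ⟨?_⟩
    rintro _ ⟨x, hx, rfl⟩ g
    obtain ⟨g, rfl⟩ := QuotientGroup.mk'_surjective K g
    exact ⟨_, hS g x hx, rfl⟩
  refine (h.map_mk'.eq_or_eq _ hnormal bot_le (Subgroup.map_subtype_le S)).imp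
    (Subgroup.map_eq_bot_iff_of_injective S hι).1 fun htop => Subgroup.map_injective hι ?_
  rw [htop, ← MonoidHom.range_eq_map, Subgroup.range_subtype]

theorem isCentralFactor_iff (hF : F.IsFormation) [Finite G] (h : IsChiefFactor K L) :
    (nilpotentGroups.prod F).IsCentralFactor K L ↔ ⁅F.residual G, L⁆ ≤ K := by
  have : Nontrivial (L.map (QuotientGroup.mk' K)) :=
    (Subgroup.nontrivial_iff_ne_bot _).2 h.map_mk'.ne_bot
  have hirr := isChiefFactor_range_inl (φ := QuotientGroup.kerLift (factorAction K L))
    fun S hS => h.eq_bot_or_eq_top_of_factorAction_mem S fun g => hS g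
  rw [IsCentralFactor, nilpotentGroups_prod_mem_semidirectProduct_iff hF
    (QuotientGroup.kerLift_injective _) range_conj_le_range_kerLift_factorAction hirr,
    hF.mem_iff_residual_le_ker (QuotientGroup.mk'_surjective _), QuotientGroup.ker_mk',
    le_ker_factorAction_iff]

end CentralFactor

section Hypercentre

variable {π : Set Nat.Primes} {F : GroupClass.{u}} {G : Type u} [Group G]

theorem isHypercentral_iff (hF : F.IsFormation) [Finite G] {N : Subgroup G} :
    IsHypercentral π (nilpotentGroups.prod F) N ↔
      N.Normal ∧ CentralizesPiFactors π (F.residual G) ⊥ N := by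
  refine and_congr_right fun _ => ⟨fun h K L hKL _ hL hp => ?_, fun h K L _ _ hKL hL hp => ?_⟩
  · have := hKL.normal_bot
    have := hKL.normal_top
    exact (isCentralFactor_iff hF hKL).1 (h K L hKL hL hp)
  · exact (isCentralFactor_iff hF hKL).2 (h K L hKL bot_le hL hp)

theorem isHypercentral_hypercentre (hF : F.IsFormation) [Finite G] :
    IsHypercentral π (nilpotentGroups.prod F) (hypercentre π (nilpotentGroups.prod F) G) := by
  have hsup : SupClosed {N : Subgroup G | IsHypercentral π (nilpotentGroups.prod F) N} := by
    intro M hM N hN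
    obtain ⟨_, hM⟩ := (isHypercentral_iff hF).1 hM
    obtain ⟨_, hN⟩ := (isHypercentral_iff hF).1 hN
    exact (isHypercentral_iff hF).2 ⟨inferInstance, hN.sup hM⟩
  refine hsup.sSup_mem (Set.toFinite _) ?_ subset_rfl
  exact ⟨inferInstance, fun K L _ _ hKL hL => absurd hL (bot_le.trans_lt hKL.lt).not_ge⟩

theorem le_hypercentre (hF : F.IsFormation) [Finite G] {N : Subgroup G} [hN : N.Normal]
    (h : CentralizesPiFactors π (F.residual G) ⊥ N) :
    N ≤ hypercentre π (nilpotentGroups.prod F) G :=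
  le_sSup ((isHypercentral_iff hF).2 ⟨hN, h⟩)

end Hypercentre

end GroupClass

namespace GroupClass

section Norm

variable {π σ : Set Nat.Primes} {X Y F : GroupClass.{u}} {G H : Type u} [Group G] [Group H]

theorem mem_norm_iff {x : G} : x ∈ X.norm F G ↔ ∀ K : Subgroup G,
    x ∈ Subgroup.normalizer ((F.subgroupResidual K ⊔ X.radical G : Subgroup G) : Set G) := by
  rw [norm, Subgroup.mem_iInf]
  rfl

theorem radical_le_norm : X.radical G ≤ X.norm F G :=
  le_iInf fun _ => le_sup_right.trans Subgroup.le_normalizer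

theorem mem_normalizer_subgroupResidual (hX : X.radical G = ⊥) {x : G} (hx : x ∈ X.norm F G)
    (K : Subgroup G) : x ∈ Subgroup.normalizer (F.subgroupResidual K : Set G) := by
  have := mem_norm_iff.1 hx K
  rwa [hX, sup_bot_eq] at this

theorem mem_norm_of_forall_mem_normalizer {x : G}
    (h : ∀ K : Subgroup G, x ∈ Subgroup.normalizer (F.subgroupResidual K : Set G)) :
    x ∈ X.norm F G :=
  mem_norm_iff.2 fun K => Subgroup.normalizer_le_normalizer_sup_normal (h K)

theorem le_norm_of_commutator_eq_bot (hF : F.IsFormation) (hS : F.IsSubgroupClosed) [Finite G]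
    {L : Subgroup G} (h : ⁅F.residual G, L⁆ = ⊥) : L ≤ X.norm F G := by
  rw [Subgroup.commutator_comm, Subgroup.commutator_eq_bot_iff_le_centralizer] at h
  exact fun x hx => mem_norm_of_forall_mem_normalizer fun K =>
    Subgroup.centralizer_le_normalizer _
      (Subgroup.centralizer_le (hF.subgroupResidual_le_residual hS K) (h hx))

theorem map_radical_piGroups_le [Finite G] {f : G →* H} (hf : Function.Surjective f) :
    ((piGroups σ).radical G).map f ≤ (piGroups σ).radical H := by
  have := Finite.of_surjective f hf
  have : (((piGroups σ).radical G).map f).Normal := Subgroup.Normal.map inferInstance f hf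
  exact le_radical (piGroups_mem_of_card_dvd (Subgroup.card_map_dvd _ _) piGroups_mem_radical)

theorem map_norm_le (hF : F.IsFormation) [Finite G] {f : G →* H} (hf : Function.Surjective f) :
    ((piGroups σ).norm F G).map f ≤ (piGroups σ).norm F H := by
  rintro _ ⟨x, hx, rfl⟩
  refine mem_norm_iff.2 fun K => ?_
  have hK := Subgroup.normalizer_le_normalizer_sup_normal (K := (piGroups σ).radical H)
    (Subgroup.le_normalizer_map f ⟨x, mem_norm_iff.1 hx (K.comap f), rfl⟩)
  rwa [Subgroup.map_sup, hF.map_subgroupResidual, Subgroup.map_comap_eq_self_of_surjective hf,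
    sup_assoc, sup_eq_right.2 (map_radical_piGroups_le hf)] at hK

theorem subgroupOf_norm_le (hF : F.IsFormation) [Finite G] (hX : X.radical G = ⊥)
    (M : Subgroup G) : (X.norm F G).subgroupOf M ≤ Y.norm F M := by
  refine fun x hx => mem_norm_of_forall_mem_normalizer fun K => ?_
  have hK := mem_normalizer_subgroupResidual hX (Subgroup.mem_subgroupOf.1 hx) (K.map M.subtype)
  rw [← hF.map_subgroupResidual] at hK
  rw [Subgroup.mem_normalizer_iff] at hK ⊢
  intro y
  rw [← Subgroup.mem_map_iff_mem M.subtype_injective, hK,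
    ← Subgroup.mem_map_iff_mem M.subtype_injective]
  rfl

instance normSeries_normal (i : ℕ) : (X.normSeries F G i).Normal :=
  (normSeriesAux X F G i).2

theorem normSeries_succ (i : ℕ) : X.normSeries F G (i + 1) =
    (X.norm F (G ⧸ X.normSeries F G i)).comap (QuotientGroup.mk' (X.normSeries F G i)) := rfl

theorem normSeries_le_succ (i : ℕ) : X.normSeries F G i ≤ X.normSeries F G (i + 1) :=
  (QuotientGroup.ker_mk' _).ge.trans (Subgroup.comap_mono bot_le)

theorem exists_normInfty_eq [Finite G] : ∃ i,
    X.normInfty F G = X.normSeries F G i ∧ X.norm F (G ⧸ X.normSeries F G i) = ⊥ := by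
  have hmono : Monotone (X.normSeries F G) := monotone_nat_of_le_succ normSeries_le_succ
  obtain ⟨i, hi⟩ := WellFoundedGT.monotone_chain_condition ⟨_, hmono⟩
  refine ⟨i, le_antisymm (iSup_le fun j => ?_) (le_iSup _ i), ?_⟩
  · exact (le_total i j).elim (fun h => (hi j h).ge) fun h => hmono h
  · have hsucc : X.normSeries F G i = X.normSeries F G (i + 1) := hi (i + 1) i.le_succ
    rw [normSeries_succ] at hsucc
    rw [← Subgroup.map_comap_eq_self_of_surjective (QuotientGroup.mk'_surjective _)
      (X.norm F (G ⧸ X.normSeries F G i)), ← hsucc, QuotientGroup.map_mk'_self]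

theorem norm_le_normInfty (hF : F.IsFormation) [Finite G] :
    (piGroups σ).norm F G ≤ (piGroups σ).normInfty F G := by
  refine le_trans ?_ (le_iSup _ 1)
  rw [normSeries_succ, ← Subgroup.map_le_iff_le_comap]
  exact map_norm_le hF (QuotientGroup.mk'_surjective _)

theorem norm_ne_bot_of_centralizesPiFactors (hF : F.IsFormation) (hS : F.IsSubgroupClosed)
    [Finite G] {N : Subgroup G} [N.Normal] (hN : CentralizesPiFactors π (F.residual G) ⊥ N)
    (hN0 : N ≠ ⊥) : (piGroups πᶜ).norm F G ≠ ⊥ := by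
  obtain ⟨L, hL, hLN⟩ := exists_isChiefFactor (bot_lt_iff_ne_bot.2 hN0)
  have := hL.normal_top
  suffices L ≤ (piGroups πᶜ).norm F G from ne_bot_of_le_ne_bot hL.ne_bot this
  by_cases hp : ∃ p ∈ π, (p : ℕ) ∣ Nat.card L
  · rw [← Subgroup.relIndex_bot_left] at hp
    exact le_norm_of_commutator_eq_bot hF hS (eq_bot_iff.2 (hN ⊥ L hL le_rfl hLN hp))
  · exact (le_radical (piGroups_compl_mem_iff.2 (by simpa using hp))).trans radical_le_norm

theorem hypercentre_le_normInfty (hF : F.IsFormation) (hS : F.IsSubgroupClosed) [Finite G] :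
    hypercentre π (nilpotentGroups.prod F) G ≤ (piGroups πᶜ).normInfty F G := by
  obtain ⟨i, hi, hi0⟩ := exists_normInfty_eq (X := piGroups πᶜ) (F := F) (G := G)
  rw [hi]
  obtain ⟨_, hZ⟩ := (isHypercentral_iff hF).1 (isHypercentral_hypercentre (π := π) (G := G) hF)
  set Z := hypercentre π (nilpotentGroups.prod F) G
  set K := (piGroups πᶜ).normSeries F G i
  have hs := QuotientGroup.mk'_surjective K
  have : (Z.map (QuotientGroup.mk' K)).Normal := Subgroup.Normal.map inferInstance _ hs
  have hZK : CentralizesPiFactors π (F.residual (G ⧸ K)) ⊥ (Z.map (QuotientGroup.mk' K)) := by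
    rw [← hF.map_residual hs, ← centralizesPiFactors_comap_iff hs, MonoidHom.comap_bot,
      QuotientGroup.ker_mk', QuotientGroup.comap_map_mk', sup_comm, centralizesPiFactors_sup_iff]
    exact hZ.mono bot_le le_rfl
  by_contra hcon
  refine norm_ne_bot_of_centralizesPiFactors hF hS hZK (fun h => hcon ?_) hi0
  exact ((Subgroup.map_eq_bot_iff _).1 h).trans (QuotientGroup.ker_mk' K).le

theorem normEqHypercentre_of_quotients (hF : F.IsFormation) (hS : F.IsSubgroupClosed) [Finite G]
    (h : ∀ (N : Subgroup G) [N.Normal], CentralizesPiFactors π (F.residual (G ⧸ N)) ⊥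
      ((piGroups πᶜ).norm F (G ⧸ N))) : F.NormEqHypercentre π G := by
  refine le_antisymm (iSup_le fun i => le_hypercentre hF ?_) (hypercentre_le_normInfty hF hS)
  induction i with
  | zero => exact fun K L hKL _ hL => absurd (hL.trans bot_le) hKL.lt.not_ge
  | succ i ih =>
    have hs := QuotientGroup.mk'_surjective ((piGroups πᶜ).normSeries F G i)
    have hi := h ((piGroups πᶜ).normSeries F G i)
    rw [← hF.map_residual hs, ← centralizesPiFactors_comap_iff hs, MonoidHom.comap_bot,
      QuotientGroup.ker_mk'] at hi
    exact ih.trans bot_le (normSeries_le_succ i) hi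

theorem NormEqHypercentre.centralizesPiFactors_norm (hF : F.IsFormation) [Finite G]
    (h : F.NormEqHypercentre π G) :
    CentralizesPiFactors π (F.residual G) ⊥ ((piGroups πᶜ).norm F G) :=
  ((isHypercentral_iff hF).1 (isHypercentral_hypercentre hF)).2.mono le_rfl
    ((norm_le_normInfty hF).trans h.le)

end Norm

end GroupClass

section Complements

variable {G : Type*} [Group G] {H K K₁ K₂ L R C : Subgroup G}

open MulAction Pointwise in
theorem exists_eq_stabilizer_of_isComplement' [Finite G] [H.Normal] [IsMulCommutative H]
    (hH : Nat.Coprime (Nat.card H) H.index) (h : H.IsComplement' K) :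
    ∃ α : H.QuotientDiff, K = stabilizer G α := by
  let T : H.LeftTransversal := ⟨(K : Set G), h.symm⟩
  let α : H.QuotientDiff := Quotient.mk'' T
  have hle : K ≤ stabilizer G α := by
    intro k hk
    refine congrArg Quotient.mk'' (Subtype.ext ?_)
    exact op_smul_coe_set (K.inv_mem hk)
  refine ⟨α, Subgroup.eq_of_le_of_card_ge hle (le_of_eq ?_)⟩
  have hcard := h.card_mul_card
  rw [← (Subgroup.isComplement'_stabilizer_of_coprime (α := α) hH).card_mul_card] at hcard
  exact (Nat.eq_of_mul_eq_mul_left Nat.card_pos hcard).symm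

open MulAction in
theorem exists_map_conj_eq_of_isComplement' [Finite G] [H.Normal] [IsMulCommutative H]
    (hH : Nat.Coprime (Nat.card H) H.index) (h₁ : H.IsComplement' K₁) (h₂ : H.IsComplement' K₂) :
    ∃ h ∈ H, K₁.map (MulAut.conj h : G →* G) = K₂ := by
  obtain ⟨α, rfl⟩ := exists_eq_stabilizer_of_isComplement' hH h₁
  obtain ⟨β, rfl⟩ := exists_eq_stabilizer_of_isComplement' hH h₂
  obtain ⟨h, rfl⟩ := Subgroup.exists_smul_eq hH α β
  exact ⟨h, h.2, (stabilizer_smul_eq_stabilizer_map_conj (h : G) α).symm⟩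

theorem isComplement'_subgroupOf_iff [L.Normal] (hL : L ≤ R) (hK : K ≤ R) :
    (L.subgroupOf R).IsComplement' (K.subgroupOf R) ↔ L ⊓ K = ⊥ ∧ L ⊔ K = R := by
  have hinf : Disjoint (L.subgroupOf R) (K.subgroupOf R) ↔ L ⊓ K = ⊥ := by
    rw [disjoint_iff, Subgroup.subgroupOf, Subgroup.subgroupOf, ← Subgroup.comap_inf,
      ← Subgroup.subgroupOf, Subgroup.subgroupOf_eq_bot, disjoint_iff,
      inf_eq_left.2 (inf_le_left.trans hL)]
  have hsup : L.subgroupOf R ⊔ K.subgroupOf R = ⊤ ↔ L ⊔ K = R := by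
    rw [← Subgroup.subgroupOf_sup hL hK, Subgroup.subgroupOf_eq_top]
    exact ⟨(sup_le hL hK).antisymm, ge_of_eq⟩
  refine ⟨fun h => ⟨hinf.1 h.disjoint, hsup.1 h.sup_eq_top⟩, fun h => ?_⟩
  refine Subgroup.isComplement'_of_disjoint_and_mul_eq_univ (hinf.2 h.1) ?_
  rw [← Subgroup.normal_mul, hsup.2 h.2, Subgroup.coe_top]

theorem exists_inf_eq_bot_sup_eq_of_coprime [L.Normal] (hLR : L ≤ R)
    (hco : Nat.Coprime (Nat.card L) (L.relIndex R)) : ∃ K, L ⊓ K = ⊥ ∧ L ⊔ K = R := by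
  rw [← Nat.card_congr (Subgroup.subgroupOfEquivOfLe hLR).toEquiv] at hco
  obtain ⟨K, hK⟩ := Subgroup.exists_right_complement'_of_coprime hco
  rw [← Subgroup.comap_map_eq_self_of_injective R.subtype_injective K] at hK
  exact ⟨_, (isComplement'_subgroupOf_iff hLR (Subgroup.map_subtype_le K)).1 hK⟩

theorem exists_map_conj_eq_of_coprime [Finite G] [L.Normal] [IsMulCommutative L]
    (hco : Nat.Coprime (Nat.card L) (L.relIndex R)) (h₁ : L ⊓ K₁ = ⊥ ∧ L ⊔ K₁ = R)
    (h₂ : L ⊓ K₂ = ⊥ ∧ L ⊔ K₂ = R) : ∃ l ∈ L, K₁.map (MulAut.conj l : G →* G) = K₂ := by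
  have hLR : L ≤ R := h₁.2 ▸ le_sup_left
  have hK₁ : K₁ ≤ R := h₁.2 ▸ le_sup_right
  have hK₂ : K₂ ≤ R := h₂.2 ▸ le_sup_right
  rw [← Nat.card_congr (Subgroup.subgroupOfEquivOfLe hLR).toEquiv] at hco
  obtain ⟨l, hl, hconj⟩ := exists_map_conj_eq_of_isComplement' hco
    ((isComplement'_subgroupOf_iff hLR hK₁).2 h₁) ((isComplement'_subgroupOf_iff hLR hK₂).2 h₂)
  refine ⟨l, hl, ?_⟩
  rw [← Subgroup.map_subgroupOf_eq_of_le hK₁, ← Subgroup.map_subgroupOf_eq_of_le hK₂, ← hconj,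
    Subgroup.map_map, Subgroup.map_map]
  rfl

theorem normalizer_sup_eq_top_of_forall_map_conj
    (h : ∀ g : G, ∃ l ∈ L, K.map (MulAut.conj l : G →* G) = K.map (MulAut.conj g : G →* G)) :
    Subgroup.normalizer (K : Set G) ⊔ L = ⊤ := by
  refine eq_top_iff.2 fun g _ => ?_
  obtain ⟨l, hl, hlg⟩ := h g
  have hn : l⁻¹ * g ∈ Subgroup.normalizer (K : Set G) := by
    have hcomp (a b : G) : (MulAut.conj (a * b) : G →* G) =
        (MulAut.conj a : G →* G).comp (MulAut.conj b : G →* G) := by rw [map_mul]; rfl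
    rw [Subgroup.mem_normalizer_iff_map_conj_eq, hcomp, ← Subgroup.map_map, ← hlg,
      Subgroup.map_map, ← hcomp, inv_mul_cancel, map_one]
    exact K.map_id
  rw [← mul_inv_cancel_left l g, sup_comm]
  exact Subgroup.mul_mem_sup hl hn

theorem exists_complement_normalizer_sup_eq_top [Finite G] [L.Normal] [IsMulCommutative L]
    [hR : R.Normal] (hLR : L ≤ R) (hco : Nat.Coprime (Nat.card L) (L.relIndex R)) :
    ∃ K, L ⊓ K = ⊥ ∧ L ⊔ K = R ∧ Subgroup.normalizer (K : Set G) ⊔ L = ⊤ := by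
  obtain ⟨K, hK⟩ := exists_inf_eq_bot_sup_eq_of_coprime hLR hco
  refine ⟨K, hK.1, hK.2, normalizer_sup_eq_top_of_forall_map_conj fun g => ?_⟩
  refine exists_map_conj_eq_of_coprime hco hK ⟨?_, ?_⟩
  · conv_lhs => rw [← Subgroup.Normal.map_conj_eq L g]
    rw [← Subgroup.map_inf_eq _ _ _ (MulAut.conj g).injective, hK.1, Subgroup.map_bot]
  · conv_lhs => rw [← Subgroup.Normal.map_conj_eq L g]
    rw [← Subgroup.map_sup, hK.2, Subgroup.Normal.map_conj_eq]

theorem relIndex_eq_of_sup_eq [L.Normal] (hinf : L ⊓ K = ⊥) (hsup : L ⊔ K = R) :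
    L.relIndex R = Nat.card K := by
  rw [← hsup, sup_comm, ← relIndex_inf_eq_sup, inf_comm, hinf, Subgroup.relIndex_bot_left]

theorem isMulCommutative_of_commutator_self_eq_bot (h : ⁅L, L⁆ = ⊥) : IsMulCommutative L := by
  refine ⟨⟨fun a b => Subtype.ext ?_⟩⟩
  rw [Subgroup.commutator_eq_bot_iff_le_centralizer] at h
  exact h b.2 a a.2

theorem exists_normal_complement_of_commutator_eq_bot [Finite G] [L.Normal] [R.Normal]
    (hLR : L ≤ R) (hRL : ⁅R, L⁆ = ⊥) (hco : Nat.Coprime (Nat.card L) (L.relIndex R)) :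
    ∃ K, K.Normal ∧ L ⊓ K = ⊥ ∧ L ⊔ K = R := by
  have : IsMulCommutative L := isMulCommutative_of_commutator_self_eq_bot
    (eq_bot_iff.2 ((Subgroup.commutator_mono hLR le_rfl).trans hRL.le))
  obtain ⟨K, hinf, hsup, hK⟩ := exists_complement_normalizer_sup_eq_top hLR hco
  rw [Subgroup.commutator_comm, Subgroup.commutator_eq_bot_iff_le_centralizer] at hRL
  have hKR : K ≤ R := hsup ▸ le_sup_right
  have hLK : L ≤ Subgroup.normalizer (K : Set G) :=
    (hRL.trans (Subgroup.centralizer_le hKR)).trans (Subgroup.centralizer_le_normalizer _)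
  rw [sup_eq_left.2 hLK] at hK
  exact ⟨K, Subgroup.normalizer_eq_top_iff.1 hK, hinf, hsup⟩

theorem exists_normal_complement_of_isMulCommutative [Finite G] [L.Normal] [IsMulCommutative L]
    [R.Normal] (hL : L ≤ frattini G) (hLR : L ≤ R)
    (hco : Nat.Coprime (Nat.card L) (L.relIndex R)) : ∃ K, K.Normal ∧ L ⊓ K = ⊥ ∧ L ⊔ K = R := by
  obtain ⟨K, hinf, hsup, hK⟩ := exists_complement_normalizer_sup_eq_top hLR hco
  have htop := frattini_nongenerating (eq_top_iff.2 (hK.ge.trans (sup_le_sup_left hL _)))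
  exact ⟨K, Subgroup.normalizer_eq_top_iff.1 htop, hinf, hsup⟩

-- Reduce modulo a minimal normal subgroup `L ≤ C`; it is abelian since `frattini G` is nilpotent.
theorem exists_normal_complement_of_le_frattini [Finite G] [C.Normal] [R.Normal]
    (hC : C ≤ frattini G) (hCR : C ≤ R) (hco : Nat.Coprime (Nat.card C) (C.relIndex R)) :
    ∃ K, K.Normal ∧ C ⊓ K = ⊥ ∧ C ⊔ K = R := by
  induction hn : Nat.card G using Nat.strong_induction_on generalizing G with
  | _ n ih =>
  obtain rfl | hC0 := eq_or_ne C ⊥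
  · exact ⟨R, inferInstance, bot_inf_eq R, bot_sup_eq R⟩
  obtain ⟨L, hL, hLC⟩ := exists_isChiefFactor (bot_lt_iff_ne_bot.2 hC0)
  have := hL.normal_top
  have : IsMulCommutative L := isMulCommutative_of_commutator_self_eq_bot (eq_bot_iff.2
    ((Subgroup.commutator_mono (hLC.trans hC) le_rfl).trans
      (hL.commutator_eq_bot_of_isNilpotent frattini_nilpotent).le))
  have hs := QuotientGroup.mk'_surjective L
  have hmap {A : Subgroup G} (hA : L ≤ A) :
      (A.map (QuotientGroup.mk' L)).comap (QuotientGroup.mk' L) = A := by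
    rw [QuotientGroup.comap_map_mk', sup_eq_right.2 hA]
  have : (C.map (QuotientGroup.mk' L)).Normal := Subgroup.Normal.map inferInstance _ hs
  have : (R.map (QuotientGroup.mk' L)).Normal := Subgroup.Normal.map inferInstance _ hs
  obtain ⟨K₁, _, hinf, hsup⟩ : ∃ K₁ : Subgroup G, K₁.Normal ∧ C ⊓ K₁ = L ∧ C ⊔ K₁ = R := by
    obtain ⟨K', hK'n, hinf', hsup'⟩ := ih _ (hn ▸ card_quotient_lt hL.ne_bot)
      (Subgroup.map_le_iff_le_comap.2 (hC.trans (frattini_le_comap_frattini_of_surjective hs)))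
      (Subgroup.map_mono hCR)
      ((hco.coprime_dvd_left (Subgroup.card_map_dvd _ _)).coprime_dvd_right
        (by rw [← Subgroup.relIndex_comap, hmap hLC])) rfl
    refine ⟨K'.comap (QuotientGroup.mk' L), hK'n.comap _, ?_, ?_⟩
    · rw [← hmap hLC, ← Subgroup.comap_inf, hinf', MonoidHom.comap_bot, QuotientGroup.ker_mk']
    · rw [← hmap (hLC.trans hCR), ← hsup', ← Subgroup.comap_sup_eq _ _ _ hs, hmap hLC]
  have hrel : L.relIndex K₁ = C.relIndex R := by
    rw [← hsup, sup_comm, ← relIndex_inf_eq_sup, inf_comm, hinf]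
  obtain ⟨K, hKn, hLK, hLK'⟩ := exists_normal_complement_of_isMulCommutative (hLC.trans hC)
    (hinf ▸ inf_le_right) (hrel ▸ hco.coprime_dvd_left (Subgroup.card_dvd_of_le hLC))
  refine ⟨K, hKn, ?_, ?_⟩
  · have hCK : C ⊓ K ≤ L := hinf ▸ inf_le_inf_left C (hLK' ▸ le_sup_right)
    exact eq_bot_iff.2 ((le_inf hCK inf_le_right).trans hLK.le)
  · rw [← hsup, ← hLK', ← sup_assoc, sup_eq_left.2 hLC]

end Complements

namespace GroupClass

section PiNilpotent

variable {π : Set Nat.Primes} {G : Type u} [Group G] {D L R : Subgroup G}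

theorem exists_normal_piGroup_lowerCentralSeries_le_of_commutator_eq_bot [Finite G] [L.Normal]
    [R.Normal] (hLR : L ≤ R) (hRD : R ≤ D) (hDL : ⁅D, L⁆ = ⊥) {p : Nat.Primes} (hp : p ∈ π)
    (hL : IsPGroup p L) (hR : ∀ q ∈ π, ¬ (q : ℕ) ∣ L.relIndex R) {m : ℕ}
    (hm : D.lowerCentralSeries m ≤ R) :
    ∃ K : Subgroup G,
      K.Normal ∧ K ≤ R ∧ (piGroups πᶜ).Mem K ∧ D.lowerCentralSeries (m + 1) ≤ K := by
  have hco : Nat.Coprime (Nat.card L) (L.relIndex R) := by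
    obtain ⟨k, hk⟩ := IsPGroup.iff_card.1 hL
    exact hk ▸ (p.2.coprime_iff_not_dvd.2 (hR p hp)).pow_left k
  obtain ⟨K, hK, hinf, hsup⟩ := exists_normal_complement_of_commutator_eq_bot hLR
    (eq_bot_iff.2 ((Subgroup.commutator_mono hRD le_rfl).trans hDL.le)) hco
  refine ⟨K, hK, hsup ▸ le_sup_right, piGroups_compl_mem_iff.2 ?_, ?_⟩
  · rwa [← relIndex_eq_of_sup_eq hinf hsup]
  · rw [Subgroup.lowerCentralSeries_succ, Subgroup.commutator_comm]
    refine (Subgroup.commutator_mono le_rfl (hm.trans hsup.ge)).trans (commutator_sup_le_iff.2 ?_)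
    exact ⟨hDL.le.trans bot_le, Subgroup.commutator_le_right D K⟩

theorem exists_normal_piGroup_lowerCentralSeries_le [Finite G] [D.Normal]
    (hD : CentralizesPiFactors π D ⊥ D) : ∃ K : Subgroup G, K.Normal ∧ K ≤ D ∧
      (piGroups πᶜ).Mem K ∧ ∃ m, D.lowerCentralSeries m ≤ K := by
  induction hn : Nat.card G using Nat.strong_induction_on generalizing G with
  | _ n ih =>
  obtain rfl | hD0 := eq_or_ne D ⊥
  · exact ⟨⊥, inferInstance, le_rfl, piGroups_mem_bot, 0, le_rfl⟩
  obtain ⟨L, hL, hLD⟩ := exists_isChiefFactor (bot_lt_iff_ne_bot.2 hD0)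
  have := hL.normal_top
  have hs := QuotientGroup.mk'_surjective L
  have hmap : (D.map (QuotientGroup.mk' L)).comap (QuotientGroup.mk' L) = D := by
    rw [QuotientGroup.comap_map_mk', sup_eq_right.2 hLD]
  obtain ⟨R, _, hLR, hRD, hRπ, m, hm⟩ : ∃ R : Subgroup G, R.Normal ∧ L ≤ R ∧ R ≤ D ∧
      (∀ p ∈ π, ¬ (p : ℕ) ∣ L.relIndex R) ∧ ∃ m, D.lowerCentralSeries m ≤ R := by
    have : (D.map (QuotientGroup.mk' L)).Normal := Subgroup.Normal.map inferInstance _ hs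
    obtain ⟨K, hK, hKD, hKπ, m, hm⟩ := ih _ (hn ▸ card_quotient_lt hL.ne_bot)
      (D := D.map (QuotientGroup.mk' L)) (by
        rw [← centralizesPiFactors_comap_iff hs, hmap]
        exact hD.mono bot_le le_rfl) rfl
    refine ⟨K.comap (QuotientGroup.mk' L), hK.comap _, ?_, ?_, ?_, m, ?_⟩
    · exact (QuotientGroup.ker_mk' L).ge.trans (Subgroup.comap_mono bot_le)
    · exact hmap ▸ Subgroup.comap_mono hKD
    · rwa [← card_map_mk', Subgroup.map_comap_eq_self_of_surjective hs, ← piGroups_compl_mem_iff]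
    · rwa [← Subgroup.map_le_iff_le_comap, Subgroup.map_lowerCentralSeries]
  by_cases hp : ∃ p ∈ π, (p : ℕ) ∣ Nat.card L
  · obtain ⟨p, hpπ, hp⟩ := hp
    have hDL : ⁅D, L⁆ = ⊥ := eq_bot_iff.2 <|
      hD ⊥ L hL le_rfl hLD ⟨p, hpπ, by rwa [Subgroup.relIndex_bot_left]⟩
    have hLp := isPGroup_of_commutator_self_eq_bot hL hp
      (eq_bot_iff.2 ((Subgroup.commutator_mono hLD le_rfl).trans hDL.le))
    obtain ⟨K, hK, hKR, hKπ, hmK⟩ :=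
      exists_normal_piGroup_lowerCentralSeries_le_of_commutator_eq_bot hLR hRD hDL hpπ hLp hRπ hm
    exact ⟨K, hK, hKR.trans hRD, hKπ, m + 1, hmK⟩
  · refine ⟨R, inferInstance, hRD, piGroups_compl_mem_iff.2 fun p hpπ hpR => ?_, m, hm⟩
    rw [← Subgroup.relIndex_bot_left, ← Subgroup.relIndex_mul_relIndex ⊥ L R bot_le hLR,
      Subgroup.relIndex_bot_left] at hpR
    exact (p.2.dvd_mul.1 hpR).elim (fun h => hp ⟨p, hpπ, h⟩) (hRπ p hpπ)

theorem piNilpotentGroups_mem_of_centralizesPiFactors [Finite G] [D.Normal]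
    (hD : CentralizesPiFactors π D ⊥ D) : (piNilpotentGroups π).Mem D := by
  obtain ⟨K, hK, hKD, hKπ, m, hm⟩ := exists_normal_piGroup_lowerCentralSeries_le hD
  refine ⟨inferInstance, K.subgroupOf D, inferInstance,
    (piGroups πᶜ).iso (Subgroup.subgroupOfEquivOfLe hKD).symm hKπ, ?_⟩
  refine Subgroup.nilpotent_iff_lowerCentralSeries.2 ⟨m, ?_⟩
  rwa [← Subgroup.map_top_of_surjective _ (QuotientGroup.mk'_surjective (K.subgroupOf D)),
    ← Subgroup.map_lowerCentralSeries, Subgroup.map_eq_bot_iff, QuotientGroup.ker_mk',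
    Subgroup.subgroupOf, ← Subgroup.map_le_iff_le_comap, Subgroup.top_subtype_lowerCentralSeries]

end PiNilpotent

end GroupClass

section CoprimeAction

open scoped commutatorElement

theorem commutatorElement_pow_orderOf {G : Type*} [Group G] {x l : G} (h : Commute x ⁅x, l⁆) :
    ⁅x, l⁆ ^ orderOf x = 1 := by
  have hl : ⁅x, l⁆ = x * (l * x⁻¹ * l⁻¹) := by simp only [commutatorElement_def, mul_assoc]
  have hx : Commute x (l * x⁻¹ * l⁻¹) := by
    rw [eq_inv_mul_iff_mul_eq.2 hl.symm]
    exact (Commute.refl x).inv_right.mul_right h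
  rw [hl, hx.mul_pow, conj_pow, inv_pow, pow_orderOf_eq_one, inv_one, mul_one, mul_inv_cancel,
    one_mul]

theorem dvd_relIndex_of_isPGroup {G : Type*} [Group G] [Finite G] {p : ℕ} [hp : Fact p.Prime]
    {U L : Subgroup G} (hL : IsPGroup p L) (h : U < L) : p ∣ U.relIndex L := by
  obtain ⟨n, hn⟩ := hL.index (U.subgroupOf L)
  rw [Subgroup.relIndex, hn]
  refine dvd_pow_self p fun h0 => h.not_ge (Subgroup.relIndex_eq_one.1 ?_)
  rw [Subgroup.relIndex, hn, h0, pow_zero]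

variable {π : Set Nat.Primes} {G : Type u} [Group G] [Finite G] {D L : Subgroup G}

theorem commute_of_coprime_orderOf [L.Normal] {p : Nat.Primes} (hp : p ∈ π) (hL : IsPGroup p L)
    (hDL : CentralizesPiFactors π D ⊥ L) {x : G} (hx : x ∈ D)
    (hxp : Nat.Coprime p (orderOf x)) : ∀ l ∈ L, Commute x l := by
  obtain ⟨U, hU⟩ := (Set.toFinite {U : Subgroup G | U.Normal ∧ U ≤ L ∧
    ∀ l ∈ U, Commute x l}).exists_maximal
    ⟨⊥, inferInstance, bot_le, fun l hl => Subgroup.mem_bot.1 hl ▸ Commute.one_right x⟩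
  obtain ⟨_, hUL, hUx⟩ := hU.prop
  obtain rfl | hlt := hUL.eq_or_lt
  · exact hUx
  exfalso
  obtain ⟨Y, hY, hYL⟩ := exists_isChiefFactor hlt
  have hDY : ⁅D, Y⁆ ≤ U :=
    hDL U Y hY bot_le hYL ⟨p, hp, dvd_relIndex_of_isPGroup (hL.to_le hYL) hY.lt⟩
  refine hY.lt.not_ge (hU.le_of_ge ⟨hY.normal_top, hYL, fun l hl => ?_⟩ hY.lt.le)
  have hu : ⁅x, l⁆ ∈ U := hDY (Subgroup.commutator_mem_commutator hx hl)
  have hpow := commutatorElement_pow_orderOf (hUx _ hu)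
  have hco := hL.orderOf_coprime hxp ⟨_, hUL hu⟩
  rw [Subgroup.orderOf_mk] at hco
  rw [← commutatorElement_eq_one_iff_commute, ← orderOf_eq_one_iff]
  exact hco.eq_one_of_dvd (orderOf_dvd_of_pow_eq_one hpow)

end CoprimeAction

namespace GroupClass

variable {π : Set Nat.Primes} {F : GroupClass.{u}} {G : Type u} [Group G] {L : Subgroup G}

theorem IsFormation.residual_le_sup (hF : F.IsFormation) [Finite G] {M N : Subgroup G} [N.Normal]
    (h : M ⊔ N = ⊤) : F.residual G ≤ F.subgroupResidual M ⊔ N := by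
  have hs := QuotientGroup.mk'_surjective N
  have htop : M.map (QuotientGroup.mk' N) = ⊤ := by
    rw [← Subgroup.map_top_of_surjective _ hs, ← h, Subgroup.map_sup, QuotientGroup.map_mk'_self,
      sup_bot_eq]
  have hle : (F.residual G).map (QuotientGroup.mk' N) ≤
      (F.subgroupResidual M).map (QuotientGroup.mk' N) := by
    rw [hF.map_residual hs, hF.map_subgroupResidual, htop, hF.subgroupResidual_top]
  rwa [Subgroup.map_le_map_iff, QuotientGroup.ker_mk'] at hle

theorem IsFormation.isCritical_prod_piGroups (hF : F.IsFormation) (hS : F.IsSubgroupClosed)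
    [Finite G] {σ : Set Nat.Primes} (hG : ¬ (piGroups σ).Mem (F.residual G))
    (hM : ∀ M : Subgroup G, IsCoatom M → (piGroups σ).Mem (F.subgroupResidual M)) :
    ((piGroups σ).prod F).IsCritical G := by
  refine ⟨inferInstance, fun h => hG h.2, fun H hH => ⟨inferInstance, ?_⟩⟩
  obtain ⟨M, hMco, hHM⟩ := (eq_top_or_exists_le_coatom H).resolve_left hH.ne
  rw [← mem_subgroupResidual_iff]
  exact piGroups_mem_of_le (hF.subgroupResidual_mono hS hHM) (hM M hMco)

/-- `L` is the unique minimal normal subgroup of `G`, its order is divisible by a prime in `π`, it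
is not centralized by the residual `G^F`, it normalizes the residuals of all subgroups, and the
residual of a proper subgroup `M ≥ L` centralizes the chief factors of `M` below `L` of order
divisible by a prime in `π`. Such an `L` exists in a group of least order whose norm is not
hypercentral. -/
structure IsMinimalObstruction (π : Set Nat.Primes) (F : GroupClass.{u}) {G : Type u} [Group G]
    (L : Subgroup G) : Prop where
  chief : IsChiefFactor ⊥ L
  le_of_normal : ∀ X : Subgroup G, X.Normal → X ≠ ⊥ → L ≤ X
  exists_dvd : ∃ p ∈ π, (p : ℕ) ∣ Nat.card L
  commutator_ne_bot : ⁅F.residual G, L⁆ ≠ ⊥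
  le_normalizer : ∀ H : Subgroup G, L ≤ Subgroup.normalizer (F.subgroupResidual H : Set G)
  centralizes : ∀ M : Subgroup G, M ≠ ⊤ → L ≤ M →
    CentralizesPiFactors π (F.residual M) ⊥ (L.subgroupOf M)

namespace IsMinimalObstruction

theorem le_residual (h : IsMinimalObstruction π F L) : L ≤ F.residual G :=
  h.le_of_normal _ inferInstance fun hbot =>
    h.commutator_ne_bot (by rw [hbot, Subgroup.commutator_bot_left])

theorem not_piGroups_compl_mem (h : IsMinimalObstruction π F L) : ¬ (piGroups πᶜ).Mem L := by
  obtain ⟨p, hp, hpL⟩ := h.exists_dvd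
  exact fun hL => hL.2 p hpL hp

theorem not_piGroups_singleton_mem_residual (h : IsMinimalObstruction π F L) [Finite G]
    (p : Nat.Primes) : ¬ (piGroups {p}).Mem (F.residual G) := fun hp =>
  h.commutator_ne_bot
    (h.chief.commutator_eq_bot_of_isNilpotent (piGroups_singleton_mem_iff.1 hp).isNilpotent)

theorem subgroupResidual_eq_bot_of_not_le (h : IsMinimalObstruction π F L) (hF : F.IsFormation)
    [Finite G] {M : Subgroup G} (hLM : ¬ L ≤ M) (hML : M ⊔ L = ⊤) : F.subgroupResidual M = ⊥ := by
  by_contra hne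
  refine hLM ((h.le_of_normal _ ?_ hne).trans (subgroupResidual_le M))
  rw [← Subgroup.normalizer_eq_top_iff, eq_top_iff, ← hML]
  exact sup_le (Subgroup.le_normalizer.trans (hF.normalizer_le_normalizer_subgroupResidual M))
    (h.le_normalizer M)

theorem map_commutator_residual_eq_bot (h : IsMinimalObstruction π F L) {M : Subgroup G}
    (hM : M ≠ ⊤) (hLM : L ≤ M) {X : Subgroup M} (hX : IsChiefFactor ⊥ X)
    (hXL : X ≤ L.subgroupOf M) (hπ : ∃ p ∈ π, (p : ℕ) ∣ Nat.card X) :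
    ⁅F.residual M, X⁆ = ⊥ :=
  eq_bot_iff.2 (h.centralizes M hM hLM ⊥ X hX le_rfl hXL (by rwa [Subgroup.relIndex_bot_left]))

section NonAbelian

theorem centralizer_eq_bot (h : IsMinimalObstruction π F L) (hL : ⁅L, L⁆ ≠ ⊥) :
    Subgroup.centralizer (L : Set G) = ⊥ := by
  have := h.chief.normal_top
  by_contra hne
  exact hL (Subgroup.commutator_eq_bot_iff_le_centralizer.2 (h.le_of_normal _ inferInstance hne))

theorem residual_inf_subgroupOf_eq_bot (h : IsMinimalObstruction π F L) [Finite G]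
    (hL : ⁅L, L⁆ ≠ ⊥) {M : Subgroup G} (hM : M ≠ ⊤) (hLM : L ≤ M) :
    F.residual M ⊓ L.subgroupOf M = ⊥ := by
  have := h.chief.normal_top
  by_contra hne
  obtain ⟨X, hX, hXle⟩ := exists_isChiefFactor (bot_lt_iff_ne_bot.2 hne)
  have hXL := hXle.trans inf_le_right
  by_cases hπ : ∃ p ∈ π, (p : ℕ) ∣ Nat.card X
  · have hXX : ⁅X, X⁆ = ⊥ := eq_bot_iff.2
      ((Subgroup.commutator_mono (hXle.trans inf_le_left) le_rfl).trans
        (h.map_commutator_residual_eq_bot hM hLM hX hXL hπ).le)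
    obtain ⟨p, -, hp⟩ := hπ
    have hXp := piGroups_singleton_mem_iff.2 (isPGroup_of_commutator_self_eq_bot hX hp hXX)
    have hLp := piGroups_mem_of_isChiefFactor_subgroupOf h.chief hLM hX hXL hXp
    exact hL (commutator_self_eq_bot_of_isPGroup h.chief (piGroups_singleton_mem_iff.1 hLp))
  · refine h.not_piGroups_compl_mem (piGroups_mem_of_isChiefFactor_subgroupOf h.chief hLM hX hXL ?_)
    exact piGroups_compl_mem_iff.2 fun p hp hpX => hπ ⟨p, hp, hpX⟩

theorem subgroupResidual_eq_bot_of_isCoatom (h : IsMinimalObstruction π F L) (hF : F.IsFormation)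
    [Finite G] (hL : ⁅L, L⁆ ≠ ⊥) {M : Subgroup G} (hM : IsCoatom M) :
    F.subgroupResidual M = ⊥ := by
  by_cases hLM : L ≤ M
  · have := h.chief.normal_top
    have hcomm : ⁅F.residual M, L.subgroupOf M⁆ = ⊥ := eq_bot_iff.2
      ((Subgroup.commutator_le_inf _ _).trans (h.residual_inf_subgroupOf_eq_bot hL hM.1 hLM).le)
    have hmap := congrArg (Subgroup.map M.subtype) hcomm
    rw [Subgroup.map_commutator, Subgroup.map_bot, Subgroup.map_subgroupOf_eq_of_le hLM,
      Subgroup.commutator_eq_bot_iff_le_centralizer, h.centralizer_eq_bot hL] at hmap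
    exact eq_bot_iff.2 hmap
  · exact h.subgroupResidual_eq_bot_of_not_le hF hLM (hM.2 _ (left_lt_sup.2 hLM))

theorem not_piSolvableGroups_mem_residual_of_commutator_ne_bot (h : IsMinimalObstruction π F L)
    [Finite G] (hL : ⁅L, L⁆ ≠ ⊥) : ¬ (piSolvableGroups π).Mem (F.residual G) := by
  intro hsolv
  obtain ⟨p, -, hp⟩ | hπ := mem_piGroups_of_mem_piSolvableGroups h.chief h.le_residual hsolv
  · exact hL (commutator_self_eq_bot_of_isPGroup h.chief (piGroups_singleton_mem_iff.1 hp))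
  · exact h.not_piGroups_compl_mem hπ

end NonAbelian

section Abelian

variable {p : Nat.Primes}

theorem le_frattini (h : IsMinimalObstruction π F L) (hF : F.IsFormation) [Finite G]
    (hL : ⁅L, L⁆ = ⊥) : L ≤ frattini G := by
  have := h.chief.normal_top
  refine le_iInf₂ fun M hM => not_not.1 fun hLM => h.commutator_ne_bot ?_
  have hML : M ⊔ L = ⊤ := hM.2 _ (left_lt_sup.2 hLM)
  have hres := hF.residual_le_sup hML
  rw [h.subgroupResidual_eq_bot_of_not_le hF hLM hML, bot_sup_eq] at hres
  exact eq_bot_iff.2 ((Subgroup.commutator_mono hres le_rfl).trans hL.le)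

theorem exists_le_commutator_subgroupResidual_eq_bot (h : IsMinimalObstruction π F L) [Finite G]
    (hp : p ∈ π) (hL : IsPGroup p L) {M : Subgroup G} (hM : M ≠ ⊤) (hLM : L ≤ M) :
    ∃ X ≤ L, X ≠ ⊥ ∧ ⁅F.subgroupResidual M, X⁆ = ⊥ := by
  obtain ⟨X, hX, hXL⟩ := exists_isChiefFactor_subgroupOf h.chief hLM
  have hXp : IsPGroup p X :=
    (hL.comap_of_injective M.subtype M.subtype_injective).to_le hXL
  have hdvd : (p : ℕ) ∣ Nat.card X := by
    rw [← Subgroup.relIndex_bot_left]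
    exact dvd_relIndex_of_isPGroup hXp hX.lt
  refine ⟨X.map M.subtype, Subgroup.map_le_iff_le_comap.2 hXL, ?_, ?_⟩
  · rw [Ne, Subgroup.map_eq_bot_iff_of_injective _ M.subtype_injective]
    exact hX.ne_bot
  · rw [subgroupResidual, ← Subgroup.map_commutator,
      h.map_commutator_residual_eq_bot hM hLM hX hXL ⟨p, hp, hdvd⟩, Subgroup.map_bot]

theorem commutator_residual_ne_bot (h : IsMinimalObstruction π F L) {X : Subgroup G}
    (hX : X ≠ ⊥) : ⁅F.residual G, X⁆ ≠ ⊥ := by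
  intro hcomm
  rw [Subgroup.commutator_comm, Subgroup.commutator_eq_bot_iff_le_centralizer] at hcomm
  have hL := h.le_of_normal _ inferInstance (ne_bot_of_le_ne_bot hX hcomm)
  rw [← Subgroup.commutator_eq_bot_iff_le_centralizer, Subgroup.commutator_comm] at hL
  exact h.commutator_ne_bot hL

theorem centralizer_le_frattini (h : IsMinimalObstruction π F L) (hF : F.IsFormation) [Finite G]
    (hp : p ∈ π) (hL : IsPGroup p L) : Subgroup.centralizer (L : Set G) ≤ frattini G := by
  have := h.chief.normal_top
  have hab := commutator_self_eq_bot_of_isPGroup h.chief hL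
  refine le_iInf₂ fun M hM => not_not.1 fun hCM => ?_
  obtain ⟨X, hXL, hX, hcomm⟩ := h.exists_le_commutator_subgroupResidual_eq_bot hp hL hM.1
    ((h.le_frattini hF hab).trans (frattini_le_coatom hM))
  refine h.commutator_residual_ne_bot hX ?_
  rw [Subgroup.commutator_eq_bot_iff_le_centralizer] at hcomm ⊢
  exact (hF.residual_le_sup (hM.2 _ (left_lt_sup.2 hCM))).trans
    (sup_le hcomm (Subgroup.centralizer_le hXL))

theorem isPGroup_centralizer (h : IsMinimalObstruction π F L) (hF : F.IsFormation) [Finite G]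
    (hp : p ∈ π) (hL : IsPGroup p L) : IsPGroup p (Subgroup.centralizer (L : Set G)) := by
  have := h.chief.normal_top
  rw [← piGroups_singleton_mem_iff, piGroups_mem_iff]
  intro q hq
  obtain ⟨Q⟩ : Nonempty (Sylow q (Subgroup.centralizer (L : Set G))) := inferInstance
  have hnorm := frattini_nongenerating (eq_top_iff.2
    (Q.normalizer_sup_eq_top.ge.trans (sup_le_sup_left (h.centralizer_le_frattini hF hp hL) _)))
  have hQ := h.le_of_normal _ (Subgroup.normalizer_eq_top_iff.1 hnorm) (by
    rw [Ne, Subgroup.map_eq_bot_iff_of_injective _ (Subgroup.subtype_injective _)]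
    exact Q.ne_bot_of_dvd_card hq)
  have hLq := piGroups_singleton_mem_iff.2 ((Q.isPGroup'.map _).to_le hQ)
  have hpL : (p : ℕ) ∣ Nat.card L := by
    rw [← Subgroup.relIndex_bot_left]
    exact dvd_relIndex_of_isPGroup hL h.chief.lt
  exact (hLq.2 p hpL).symm

-- By the coprime action on `L`, the `p'`-elements of `M^F` lie in the `p`-group `C_G(L)`.
theorem piGroups_mem_subgroupResidual_of_isCoatom (h : IsMinimalObstruction π F L)
    (hF : F.IsFormation) [Finite G] (hp : p ∈ π) (hL : IsPGroup p L) {M : Subgroup G}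
    (hM : IsCoatom M) : (piGroups {p}).Mem (F.subgroupResidual M) := by
  have := h.chief.normal_top
  have hLM : L ≤ M := (h.le_frattini hF (commutator_self_eq_bot_of_isPGroup h.chief hL)).trans
    (frattini_le_coatom hM)
  rw [mem_subgroupResidual_iff, piGroups_mem_iff]
  refine fun q hq => by_contra fun hqp => ?_
  have hpq : Nat.Coprime p q :=
    (Nat.coprime_primes p.2 q.2).2 fun hpq => hqp (Subtype.ext hpq).symm
  obtain ⟨x, hx⟩ := exists_prime_orderOf_dvd_card' (q : ℕ) hq
  rw [← Subgroup.orderOf_coe] at hx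
  have hxL : ((x : M) : G) ∈ Subgroup.centralizer (L : Set G) := by
    refine Subgroup.mem_centralizer_iff.2 fun l hl => ?_
    have hcomm := commute_of_coprime_orderOf hp
      (hL.comap_of_injective M.subtype M.subtype_injective) (h.centralizes M hM.1 hLM) x.2
      (hx ▸ hpq) ⟨l, hLM hl⟩ hl
    exact (congrArg Subtype.val hcomm.eq).symm
  have hco := (h.isPGroup_centralizer hF hp hL).orderOf_coprime hpq ⟨_, hxL⟩
  rw [Subgroup.orderOf_mk, Subgroup.orderOf_coe, hx, Nat.coprime_self] at hco
  exact q.2.ne_one hco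

theorem not_piSolvableGroups_mem_residual_of_isPGroup (h : IsMinimalObstruction π F L)
    (hF : F.IsFormation) [Finite G] (hp : p ∈ π) (hL : IsPGroup p L) :
    ¬ (piSolvableGroups π).Mem (F.residual G) := by
  intro hsolv
  have := h.chief.normal_top
  have hLC : L ≤ Subgroup.centralizer (L : Set G) ⊓ F.residual G :=
    le_inf (Subgroup.commutator_eq_bot_iff_le_centralizer.1
      (commutator_self_eq_bot_of_isPGroup h.chief hL)) h.le_residual
  obtain ⟨c, hc⟩ := IsPGroup.iff_card.1 ((h.isPGroup_centralizer hF hp hL).to_le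
    (inf_le_left : Subgroup.centralizer (L : Set G) ⊓ F.residual G ≤ _))
  obtain ⟨R, hR, hRD⟩ := exists_isChiefFactor (inf_le_right.lt_of_ne fun hC =>
    h.commutator_ne_bot (Subgroup.commutator_eq_bot_iff_le_centralizer.2 (inf_eq_right.1 hC)))
  have := hR.normal_top
  by_cases hpR : (p : ℕ) ∣ (Subgroup.centralizer (L : Set G) ⊓ F.residual G).relIndex R
  · obtain ⟨q, -, n, hn⟩ | hπ := relIndex_of_mem_piSolvableGroups hR hRD hsolv
    · have hpq : (p : ℕ) = q := (Nat.prime_dvd_prime_iff_eq p.2 q.2).1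
        (p.2.dvd_of_dvd_pow (hn ▸ hpR))
      have hRp : IsPGroup p R := IsPGroup.of_card (n := c + n) (by
        rw [← Subgroup.relIndex_bot_left, ← Subgroup.relIndex_mul_relIndex _ _ R bot_le hR.lt.le,
          Subgroup.relIndex_bot_left, hc, hn, hpq, pow_add])
      exact hR.lt.not_ge (le_inf (Subgroup.commutator_eq_bot_iff_le_centralizer.1
        (h.chief.commutator_eq_bot_of_isNilpotent hRp.isNilpotent)) hRD)
    · exact hπ p hp hpR
  · obtain ⟨K, hK, hinf, hsup⟩ := exists_normal_complement_of_le_frattini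
      (inf_le_left.trans (h.centralizer_le_frattini hF hp hL)) hR.lt.le
      (hc ▸ ((p.2.coprime_iff_not_dvd.2 hpR).pow_left c))
    have hK0 : K ≠ ⊥ := fun hK0 => hR.lt.ne (by rw [← hsup, hK0, sup_bot_eq])
    exact h.chief.ne_bot (eq_bot_iff.2 ((le_inf hLC (h.le_of_normal K hK hK0)).trans hinf.le))

end Abelian

theorem exists_isCritical (h : IsMinimalObstruction π F L) (hF : F.IsFormation)
    (hS : F.IsSubgroupClosed) [Finite G] :
    ∃ p ∈ π, ((piGroups {p}).prod F).IsCritical G ∧ ¬ ((piSolvableGroups π).prod F).Mem G := by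
  obtain ⟨p, hp, hpL⟩ := h.exists_dvd
  have hcrit := hF.isCritical_prod_piGroups hS (h.not_piGroups_singleton_mem_residual p)
  by_cases hL : ⁅L, L⁆ = ⊥
  · have hLp := isPGroup_of_commutator_self_eq_bot h.chief hpL hL
    exact ⟨p, hp, hcrit fun M hM => h.piGroups_mem_subgroupResidual_of_isCoatom hF hp hLp hM,
      fun hsolv => h.not_piSolvableGroups_mem_residual_of_isPGroup hF hp hLp hsolv.2⟩
  · refine ⟨p, hp, hcrit fun M hM => ?_,
      fun hsolv => h.not_piSolvableGroups_mem_residual_of_commutator_ne_bot hL hsolv.2⟩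
    rw [h.subgroupResidual_eq_bot_of_isCoatom hF hL hM]
    exact piGroups_mem_bot

end IsMinimalObstruction

end GroupClass

namespace GroupClass

section Norm

variable {π : Set Nat.Primes} {F : GroupClass.{u}} {G : Type u} [Group G]

theorem IsFormation.centralizesPiFactors_norm_sup (hF : F.IsFormation) [Finite G]
    {X : Subgroup G} [X.Normal]
    (h : CentralizesPiFactors π (F.residual (G ⧸ X)) ⊥ ((piGroups πᶜ).norm F (G ⧸ X))) :
    CentralizesPiFactors π (F.residual G) X ((piGroups πᶜ).norm F G ⊔ X) := by
  have hs := QuotientGroup.mk'_surjective X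
  rw [← hF.map_residual hs, ← centralizesPiFactors_comap_iff hs, MonoidHom.comap_bot,
    QuotientGroup.ker_mk'] at h
  refine h.mono le_rfl (sup_le (Subgroup.map_le_iff_le_comap.1 (map_norm_le hF hs)) ?_)
  exact (QuotientGroup.ker_mk' X).ge.trans (Subgroup.comap_mono bot_le)

theorem exists_isMinimalObstruction (hF : F.IsFormation) [Finite G]
    (ih : ∀ (H : Type u) [Group H] [Finite H], Nat.card H < Nat.card G →
      CentralizesPiFactors π (F.residual H) ⊥ ((piGroups πᶜ).norm F H))
    (hG : ¬ CentralizesPiFactors π (F.residual G) ⊥ ((piGroups πᶜ).norm F G)) :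
    ∃ L : Subgroup G, IsMinimalObstruction π F L := by
  obtain ⟨L, hL, hLN, hmin, hπ, hcomm⟩ := exists_isChiefFactor_of_not_centralizesPiFactors hG
    fun X _ hX => hF.centralizesPiFactors_norm_sup (ih _ (card_quotient_lt hX))
  have hrad : (piGroups πᶜ).radical G = ⊥ := by
    by_contra hne
    obtain ⟨p, hp, hpL⟩ := hπ
    exact (piGroups_mem_of_le (hmin _ inferInstance hne) piGroups_mem_radical).2 p hpL hp
  refine ⟨L, hL, hmin, hπ, hcomm,
    fun H x hx => mem_normalizer_subgroupResidual hrad (hLN hx) H, fun M hM _ => ?_⟩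
  have hcard : Nat.card M < Nat.card G :=
    lt_of_le_of_ne M.card_le_card_group fun h => hM (M.eq_top_of_card_eq h)
  exact (ih M hcard).mono le_rfl
    ((Subgroup.comap_mono hLN).trans (subgroupOf_norm_le hF hrad M))

theorem centralizesPiFactors_norm_of_critical (hF : F.IsFormation) (hS : F.IsSubgroupClosed)
    (hcrit : ∀ (G : Type u) [Group G] [Finite G],
      (∃ p ∈ π, ((piGroups {p}).prod F).IsCritical G ∧ ¬ ((piSolvableGroups π).prod F).Mem G) →
      F.NormEqHypercentre π G) (G : Type u) [Group G] [Finite G] :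
    CentralizesPiFactors π (F.residual G) ⊥ ((piGroups πᶜ).norm F G) := by
  induction hn : Nat.card G using Nat.strong_induction_on generalizing G with
  | _ n ih =>
  by_contra hcon
  obtain ⟨L, hL⟩ := exists_isMinimalObstruction hF (fun H _ _ hH => ih _ (hn ▸ hH) H rfl) hcon
  exact hcon ((hcrit G (hL.exists_isCritical hF hS)).centralizesPiFactors_norm hF)

theorem normEqHypercentre_of_critical (hF : F.IsFormation) (hS : F.IsSubgroupClosed)
    (hcrit : ∀ (G : Type u) [Group G] [Finite G],
      (∃ p ∈ π, ((piGroups {p}).prod F).IsCritical G ∧ ¬ ((piSolvableGroups π).prod F).Mem G) →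
      F.NormEqHypercentre π G) (G : Type u) [Group G] [Finite G] : F.NormEqHypercentre π G :=
  normEqHypercentre_of_quotients hF hS fun N _ =>
    centralizesPiFactors_norm_of_critical hF hS hcrit (G ⧸ N)

theorem IsCritical.norm_eq_top {X : GroupClass.{u}} (hG : F.IsCritical G) (hF : F.IsFormation) :
    X.norm F G = ⊤ := by
  have := hG.1
  refine eq_top_iff.2 fun x _ => mem_norm_of_forall_mem_normalizer fun K => ?_
  have hK : (F.subgroupResidual K).Normal := by
    obtain rfl | hlt := eq_top_or_lt_top K
    · rw [hF.subgroupResidual_top]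
      infer_instance
    · rw [(hF.subgroupResidual_eq_bot_iff K).2 (hG.2.2 K hlt)]
      infer_instance
  rw [Subgroup.normalizer_eq_top]
  trivial

theorem IsCritical.mem_piNilpotentGroups_prod (hG : F.IsCritical G) (hF : F.IsFormation)
    (h : F.NormEqHypercentre π G) : ((piNilpotentGroups π).prod F).Mem G := by
  have := hG.1
  have hnorm := h.centralizesPiFactors_norm hF
  rw [hG.norm_eq_top hF] at hnorm
  exact ⟨hG.1, piNilpotentGroups_mem_of_centralizesPiFactors (hnorm.mono le_rfl le_top)⟩

end Norm

end GroupClass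

theorem theoremB (π : Set Nat.Primes) (F : GroupClass.{u}) (hF : F.IsFormation)
    (hS : F.IsSubgroupClosed) :
    (F.BoundaryConditionII π → ∀ (G : Type u) [Group G] [Finite G], F.NormEqHypercentre π G) ∧
    ((∀ (G : Type u) [Group G] [Finite G], F.NormEqHypercentre π G) → F.BoundaryConditionI π) ∧
    ((∀ (G : Type u) [Group G] [Finite G], F.NormEqHypercentre π G) ↔
      ∀ (G : Type u) [Group G] [Finite G],
        (∃ p ∈ π, ((GroupClass.piGroups {p}).prod F).IsCritical G ∧
          ¬ ((GroupClass.piSolvableGroups π).prod F).Mem G) →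
        F.NormEqHypercentre π G) := by
  refine ⟨fun hII => ?_, fun h G _ hG => ?_, fun h G _ _ _ => h G, ?_⟩
  · refine GroupClass.normEqHypercentre_of_critical hF hS fun G _ _ hG => ?_
    obtain ⟨p, hp, hcrit, hns⟩ := hG
    exact absurd (hII p hp G hcrit) hns
  · have := hG.1
    exact hG.mem_piNilpotentGroups_prod hF (h G)
  · exact GroupClass.normEqHypercentre_of_critical hF hS
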